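/- Let $n,k\ge 0$ be integers, let $e_1,\dots,e_{n+1}$ be the standard basis of $\mathbb{R}^{n+1}\subset Cl_{n+1}$, the real Clifford algebra with $v^2=-\|v\|^2$ for $v\in\mathbb{R}^{n+1}$, and let $\mathbb{R}^n$ be the span of $e_1,\dots,e_n$. For a linear subspace $H\subseteq\mathbb{R}^{n+1}$ with orthonormal basis $(f_i)$ let $D_H=\sum_i f_i\,\partial_{f_i}$ be its Dirac operator (for $H=\mathbb{R}^n$ this is $D=\sum_{j\le n}e_j\partial_j$), let $\mathcal{M}_k(H)$ be the space of $Cl_{n+1}$-valued homogeneous polynomials $p$ of degree $k$ on $H$ with $D_Hp=0$, with $\mathcal{M}_{-1}(H)=0$, and let $P_{k}:\mathcal{H}_k(H)=\mathcal{M}_k(H)\oplus w\,\mathcal{M}_{k-1}(H)\to\mathcal{M}_k(H)$, $w\in H$, be the projection. Let $C(x)=(e_{n+1}x+1)(x+e_{n+1})^{-1}=e_{n+1}+2(x+e_{n+1})^{-1}$ be the Cayley transformation $\mathbb{R}^n\to\mathbb{S}^n\setminus\{e_{n+1}\}$, and $$J(C,x)=\frac{x+e_{n+1}}{\|x+e_{n+1}\|^{n}},\qquad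 J_{-1}(C,x)=\frac{x+e_{n+1}}{\|x+e_{n+1}\|^{n+2}} .$$ The Dirac operator of $\mathbb{S}^n$ is $D_s=y\,(\Lambda+\tfrac n2)$ at $y\in\mathbb{S}^n$, with $\Lambda=\sum_{1\le i<j\le n+1}e_ie_j(y_i\partial_{y_j}-y_j\partial_{y_i})$. Let $U\subseteq\mathbb{R}^n$ be open and let $g:C(U)\times\mathbb{R}^n\to Cl_{n+1}$ be such that $(x,u)\mapsto g(C(x),u)$ is differentiable on $U\times\mathbb{R}^n$ and $g(y,\cdot)\in\mathcal{M}_k(\mathbb{R}^n)$ for each $y\in C(U)$. Extend $g(y,\cdot)$ to $\mathbb{R}^{n+1}$ so as to be constant in the direction $e_{n+1}$, and put $$F(x,w)=J(C,x)\,g\Bigl(C(x),\frac{(x+e_{n+1})\,w\,(x+e_{n+1})}{\|x+e_{n+1}\|^2}\Bigr)\qquad(x\in U,\ w\in\mathbb{R}^{n+1}).$$ Let $x\in U$, $x_s=C(x)$, and let $H_x$ be the hyperplane of all $w\in\mathbb{R}^{n+1}$ for which $(x+e_{n+1})w(x+e_{n+1})/\|x+e_{n+1}\|^2\in\mathbb{R}^n$.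 Then the function $u\mapsto D_{s,x_s}g(x_s,u)$ ($D_s$ taken for fixed $u$) lies in $\mathcal{H}_k(\mathbb{R}^n)$, the function $w\mapsto D_xF(x,w)$ on $H_x$ ($D_x$ taken for fixed $w$) lies in $\mathcal{H}_k(H_x)$, and the Rarita-Schwinger operators $R^S_{k,u}g(x_s,\cdot)=P_{k}\bigl(D_{s,x_s}g(x_s,\cdot)\bigr)$ and $R_{k,w}F(x,\cdot)=P_{k}\bigl(D_xF(x,\cdot)|_{H_x}\bigr)$ satisfy, for all $w\in H_x$ and $u=\dfrac{(x+e_{n+1})w(x+e_{n+1})}{\|x+e_{n+1}\|^2}$, $$-2\,J_{-1}(C,x)\,R^S_{k,u}\,g(x_s,u)=R_{k,w}\Bigl[J(C,x)\,g\Bigl(C(x),\frac{(x+e_{n+1})w(x+e_{n+1})}{\|x+e_{n+1}\|^2}\Bigr)\Bigr].$$ -/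

import Mathlib

/-!
Clifford analysis on `ℝⁿ` and on the unit sphere `𝕊ⁿ ⊆ ℝⁿ⁺¹`.  The ambient space is
`ℝⁿ⁺¹ = EuclideanSpace ℝ (Fin (n + 1))` with orthonormal basis `e₁, …, eₙ₊₁`, here
`stdVec 0, …, stdVec (Fin.last n)`.
-/

namespace CliffordSphere

noncomputable section

/-- The ambient Euclidean space `ℝⁿ⁺¹`. -/
abbrev Ambient (n : ℕ) : Type := EuclideanSpace ℝ (Fin (n + 1))

/-- The quadratic form `v ↦ -‖v‖²` on `ℝⁿ⁺¹`. -/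
def negNormSq (n : ℕ) : QuadraticForm ℝ (Ambient n) :=
  -(LinearMap.BilinMap.toQuadraticMap (innerₗ (Ambient n)))

theorem negNormSq_apply (n : ℕ) (v : Ambient n) : negNormSq n v = -‖v‖ ^ 2 := by
  simp [negNormSq]

/-- The real Clifford algebra `Clₙ₊₁`, in which `v² = -‖v‖²` for `v ∈ ℝⁿ⁺¹`. -/
abbrev Cl (n : ℕ) : Type := CliffordAlgebra (negNormSq n)

/-- The inclusion `ℝⁿ⁺¹ ⊆ Clₙ₊₁`. -/
def vec {n : ℕ} : Ambient n →ₗ[ℝ] Cl n := CliffordAlgebra.ι (negNormSq n)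

theorem vec_mul_self {n : ℕ} (v : Ambient n) :
    vec v * vec v = algebraMap ℝ (Cl n) (-‖v‖ ^ 2) := by
  rw [vec, CliffordAlgebra.ι_sq_scalar, negNormSq_apply]

/-- The standard basis vector `e_{j+1}`. -/
def stdVec {n : ℕ} (j : Fin (n + 1)) : Ambient n := EuclideanSpace.single j 1

/-- The last basis vector `eₙ₊₁`. -/
def eLast (n : ℕ) : Ambient n := stdVec (Fin.last n)

/-- The standard basis `(e_A)` of `Clₙ₊₁`, indexed by the subsets `A` of the index set: the basis
of the exterior algebra given by the standard basis of `ℝⁿ⁺¹`, carried over along the canonical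
linear isomorphism of the two algebras. -/
def clBasis (n : ℕ) : Module.Basis (Finset (Fin (n + 1))) ℝ (Cl n) :=
  ((EuclideanSpace.basisFun (Fin (n + 1)) ℝ).toBasis.ExteriorAlgebra).map
    (CliffordAlgebra.equivExterior (negNormSq n)).symm

/-- Coordinates `(a_A)` of an element of `Clₙ₊₁`. -/
def clCoord (n : ℕ) : Cl n ≃ₗ[ℝ] EuclideanSpace ℝ (Finset (Fin (n + 1))) :=
  (clBasis n).equivFun.trans (WithLp.linearEquiv 2 ℝ (Finset (Fin (n + 1)) → ℝ)).symm

/-- The norm `‖a‖² = ∑_A a_A²` on `Clₙ₊₁`. -/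
instance instNormedAddCommGroupCl (n : ℕ) : NormedAddCommGroup (Cl n) :=
  NormedAddCommGroup.induced (Cl n) (EuclideanSpace ℝ (Finset (Fin (n + 1))))
    (clCoord n) (clCoord n).injective

instance instNormedSpaceCl (n : ℕ) : NormedSpace ℝ (Cl n) :=
  NormedSpace.induced ℝ (Cl n) (EuclideanSpace ℝ (Finset (Fin (n + 1)))) (clCoord n)

/-- `ℝⁿ`, the span of `e₁, …, eₙ` in `ℝⁿ⁺¹`. -/
def Rn (n : ℕ) : Submodule ℝ (Ambient n) :=
  Submodule.span ℝ (Set.range fun i : Fin n => stdVec (n := n) i.castSucc)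

/-! ### Monogenic polynomials on a linear subspace -/

/-- The Dirac operator of a linear subspace `H` of `ℝⁿ⁺¹`, on functions `p : H → Clₙ₊₁`.  It is the
Dirac operator `∑_{j ≤ n+1} e_j ∂_j` of `ℝⁿ⁺¹`, applied to the extension of `p` to `ℝⁿ⁺¹` that is
constant in the directions normal to `H`.  (Equivalently it is `∑_i f_i ∂_{f_i}` for any orthonormal
basis `(f_i)` of `H`.)  For `H = ℝⁿ` it is `D = ∑_{j ≤ n} e_j ∂_j`. -/
def dirac {n : ℕ} (H : Submodule ℝ (Ambient n)) (p : H → Cl n) (w : H) : Cl n :=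
  ∑ j : Fin (n + 1), vec (stdVec j) * fderiv ℝ p w (H.orthogonalProjectionOnto (stdVec j))

/-- `p : H → Clₙ₊₁` is a homogeneous polynomial of degree `k`, that is, the restriction to the
diagonal of a `k`-linear map. -/
def IsHomPoly {n : ℕ} (H : Submodule ℝ (Ambient n)) (k : ℕ) (p : H → Cl n) : Prop :=
  ∃ φ : MultilinearMap ℝ (fun _ : Fin k => H) (Cl n), ∀ w : H, p w = φ (fun _ => w)

/-- `p ∈ 𝓜_k`: a left monogenic polynomial on `H`, homogeneous of degree `k`. -/
def IsMonogenic {n : ℕ} (H : Submodule ℝ (Ambient n)) (k : ℕ) (p : H → Cl n) : Prop :=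
  IsHomPoly H k p ∧ ∀ w : H, dirac H p w = 0

/-- `h ∈ w 𝓜_{k-1}`, with `𝓜_{-1} = 0`. -/
def IsVecMulMonogenic {n : ℕ} (H : Submodule ℝ (Ambient n)) : ℕ → (H → Cl n) → Prop
  | 0, h => ∀ w : H, h w = 0
  | k + 1, h => ∃ q : H → Cl n, IsMonogenic H k q ∧ ∀ w : H, h w = vec (w : Ambient n) * q w

/-- `p` is the component of `h` in `𝓜_k` with respect to `𝓗_k = 𝓜_k ⊕ w 𝓜_{k-1}`
(the Almansi-Fischer decomposition). -/
def IsMonogenicPart {n : ℕ} (H : Submodule ℝ (Ambient n)) (k : ℕ) (h p : H → Cl n) : Prop :=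
  IsMonogenic H k p ∧ IsVecMulMonogenic H k (fun w => h w - p w)

/-- `h` lies in `𝓗_k = 𝓜_k ⊕ w 𝓜_{k-1}`, the domain of the projection `P_k`. -/
def InFischerSpace {n : ℕ} (H : Submodule ℝ (Ambient n)) (k : ℕ) (h : H → Cl n) : Prop :=
  ∃ p : H → Cl n, IsMonogenicPart H k h p

open Classical in
/-- The left projection `P_k : 𝓗_k = 𝓜_k ⊕ w 𝓜_{k-1} → 𝓜_k` (with value `0` outside `𝓗_k`). -/
def projMonogenic {n : ℕ} (H : Submodule ℝ (Ambient n)) (k : ℕ) (h : H → Cl n) : H → Cl n :=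
  if hh : InFischerSpace H k h then Classical.choose hh else 0

/-! ### The operators on `ℝⁿ` and on the sphere -/

/-- `(D_x F)(x, ·)`, for a function `F` of `x ∈ ℝⁿ` and of a further variable `w`: the Dirac
operator of `ℝⁿ` in `x`, for fixed `w`. -/
def diracX {n : ℕ} {W : Type} (F : Rn n → W → Cl n) (x : Rn n) (w : W) : Cl n :=
  dirac (Rn n) (fun z => F z w) x

/-- The Rarita-Schwinger operator `R_{k,w} F(x, ·) = P_{k,w} D_x F(x, ·)`, where `w` varies in the
linear subspace `H`. -/
def raritaSchwinger {n : ℕ} (H : Submodule ℝ (Ambient n)) (k : ℕ) (F : Rn n → H → Cl n)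
    (x : Rn n) : H → Cl n :=
  projMonogenic H k (diracX F x)

/-- The partial derivative `∂_j`, at a point `y` of the sphere, of the extension of `f : 𝕊ⁿ → Clₙ₊₁`
that is homogeneous of degree `0`.  Only the values of `f` on the sphere enter. -/
def spherePartial {n : ℕ} (f : Ambient n → Cl n) (j : Fin (n + 1)) (y : Ambient n) : Cl n :=
  fderiv ℝ (fun v : Ambient n => f (‖v‖⁻¹ • v)) y (stdVec j)

/-- The operator `Λ = ∑_{i<j} e_i e_j (y_i ∂_j - y_j ∂_i)` on functions on the sphere.  The vector
fields `y_i ∂_j - y_j ∂_i` are tangent to the sphere. -/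
def lambdaOp {n : ℕ} (f : Ambient n → Cl n) (y : Ambient n) : Cl n :=
  ∑ i : Fin (n + 1), ∑ j ∈ Finset.Ioi i,
    vec (stdVec i) * vec (stdVec j) * (y i • spherePartial f j y - y j • spherePartial f i y)

/-- The Dirac operator `D_s = y (Λ + n/2)` of the sphere `𝕊ⁿ`. -/
def sphereDirac {n : ℕ} (f : Ambient n → Cl n) (y : Ambient n) : Cl n :=
  vec y * (lambdaOp f y + ((n : ℝ) / 2) • f y)

/-- `(D_{s,y} g)(y, ·)`, for a function `g` of `y ∈ 𝕊ⁿ` and of `u ∈ ℝⁿ`: the spherical Dirac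
operator in `y`, for fixed `u`. -/
def sphereDiracX {n : ℕ} (g : Ambient n → Rn n → Cl n) (y : Ambient n) (u : Rn n) : Cl n :=
  sphereDirac (fun z => g z u) y

/-- The spherical Rarita-Schwinger type operator `R_k^S g(y, ·) = P_k D_{s,y} g(y, ·)`. -/
def sphereRaritaSchwinger {n : ℕ} (k : ℕ) (g : Ambient n → Rn n → Cl n) (y : Ambient n) :
    Rn n → Cl n :=
  projMonogenic (Rn n) k (sphereDiracX g y)

/-! ### The Cayley transformation -/

/-- The inverse `v⁻¹ = -v / ‖v‖²` in `Clₙ₊₁` of a vector `v ≠ 0`. -/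
def vecInv {n : ℕ} (v : Ambient n) : Ambient n := -((‖v‖ ^ 2)⁻¹ • v)

theorem vec_mul_vecInv {n : ℕ} {v : Ambient n} (hv : v ≠ 0) : vec v * vec (vecInv v) = 1 := by
  have h : ‖v‖ ^ 2 ≠ 0 := by simpa using hv
  rw [vecInv, map_neg, map_smul, mul_neg, mul_smul_comm, vec_mul_self, map_neg, smul_neg, neg_neg,
    Algebra.algebraMap_eq_smul_one, smul_smul, inv_mul_cancel₀ h, one_smul]

theorem vecInv_mul_vec {n : ℕ} {v : Ambient n} (hv : v ≠ 0) : vec (vecInv v) * vec v = 1 := by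
  have h : ‖v‖ ^ 2 ≠ 0 := by simpa using hv
  rw [vecInv, map_neg, map_smul, neg_mul, smul_mul_assoc, vec_mul_self, map_neg, smul_neg, neg_neg,
    Algebra.algebraMap_eq_smul_one, smul_smul, inv_mul_cancel₀ h, one_smul]

/-- The vector `x + eₙ₊₁`, for `x ∈ ℝⁿ`. -/
def shift {n : ℕ} (x : Rn n) : Ambient n := (x : Ambient n) + eLast n

/-- The Cayley transformation `C(x) = eₙ₊₁ + 2 (x + eₙ₊₁)⁻¹ = (eₙ₊₁ x + 1)(x + eₙ₊₁)⁻¹`. -/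
def cayley {n : ℕ} (x : Rn n) : Ambient n := eLast n + (2 : ℝ) • vecInv (shift x)

theorem shift_ne_zero {n : ℕ} (x : Rn n) : shift x ≠ 0 := by
  have hx : ∀ v ∈ Rn n, v (Fin.last n) = 0 := by
    intro v hv
    induction hv using Submodule.span_induction with
    | mem v hv =>
      obtain ⟨i, rfl⟩ := hv
      simp [stdVec, (Fin.castSucc_lt_last i).ne']
    | zero => simp
    | add v w _ _ hv hw => simp [hv, hw]
    | smul c v _ hv => simp [hv]
  intro h
  have h1 := congrArg (fun v : Ambient n => v (Fin.last n)) h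
  simp [shift, eLast, stdVec, hx x x.2] at h1

theorem vec_cayley {n : ℕ} (x : Rn n) :
    vec (cayley x) = (vec (eLast n) * vec (x : Ambient n) + 1) * vec (vecInv (shift x)) := by
  have h1 := vec_mul_vecInv (shift_ne_zero x)
  have he : vec (eLast n) * vec (eLast n) = -1 := by
    rw [vec_mul_self]; simp [eLast, stdVec]
  have h2 : vec (eLast n) * vec (x : Ambient n) + 1 = vec (eLast n) * vec (shift x) + 2 := by
    rw [shift, map_add, mul_add, he, add_assoc]; norm_num
  rw [h2, add_mul, mul_assoc, h1, mul_one, cayley, map_add, map_smul, two_smul, two_mul]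

/-- The vector `y w y / ‖y‖²`, for `y ≠ 0`: the image of `w` under the reflection in the hyperplane
orthogonal to `y`. -/
def sandwich {n : ℕ} (y : Ambient n) : Ambient n →ₗ[ℝ] Ambient n :=
  ((ℝ ∙ y)ᗮ.reflection.toLinearEquiv : Ambient n →ₗ[ℝ] Ambient n)

theorem vec_sandwich {n : ℕ} (y w : Ambient n) :
    vec y * vec w * vec y = (‖y‖ ^ 2) • vec (sandwich y w) := by
  rcases eq_or_ne y 0 with rfl | hy
  · simp
  have hy2 : ‖y‖ ^ 2 ≠ 0 := by simpa using hy
  have hs : sandwich y w = w - (2 * (inner ℝ y w / ‖y‖ ^ 2)) • y := by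
    change (ℝ ∙ y)ᗮ.reflection w = _
    rw [Submodule.reflection_orthogonal_apply, Submodule.reflection_singleton_apply]
    simp only [RCLike.ofReal_real_eq_id, id, neg_sub, ← Nat.cast_smul_eq_nsmul ℝ, smul_smul]
    norm_num
  have hp : vec y * vec w + vec w * vec y = algebraMap ℝ (Cl n) (-2 * inner ℝ y w) := by
    rw [vec, CliffordAlgebra.ι_mul_ι_add_swap, QuadraticMap.polar, negNormSq_apply,
      negNormSq_apply, negNormSq_apply, norm_add_sq_real]
    congr 1
    ring
  have h3 : vec y * vec w = algebraMap ℝ (Cl n) (-2 * inner ℝ y w) - vec w * vec y :=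
    eq_sub_of_add_eq hp
  rw [h3, sub_mul, mul_assoc, vec_mul_self, hs, map_sub, map_smul, smul_sub, smul_smul,
    ← Algebra.commutes, ← Algebra.smul_def, ← Algebra.smul_def]
  have h4 : ‖y‖ ^ 2 * (2 * (inner ℝ y w / ‖y‖ ^ 2)) = 2 * inner ℝ y w := by field_simp
  rw [h4, neg_smul, neg_mul, neg_smul]
  abel

/-- The hyperplane of all `w ∈ ℝⁿ⁺¹` with `(x + eₙ₊₁) w (x + eₙ₊₁) / ‖x + eₙ₊₁‖² ∈ ℝⁿ`. -/
def hyperplane {n : ℕ} (x : Rn n) : Submodule ℝ (Ambient n) := (Rn n).comap (sandwich (shift x))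

/-- The conformal weight `J(C, x) = (x + eₙ₊₁) / ‖x + eₙ₊₁‖ⁿ`. -/
def weightJ {n : ℕ} (x : Rn n) : Cl n := (‖shift x‖ ^ n)⁻¹ • vec (shift x)

/-- The conformal weight `J₋₁(C, x) = (x + eₙ₊₁) / ‖x + eₙ₊₁‖ⁿ⁺²`. -/
def weightJneg {n : ℕ} (x : Rn n) : Cl n := (‖shift x‖ ^ (n + 2))⁻¹ • vec (shift x)

/-- The function `(x, w) ↦ J(C, x) g(C(x), (x + eₙ₊₁) w (x + eₙ₊₁) / ‖x + eₙ₊₁‖²)`, where `g(y, ·)`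
is extended from `ℝⁿ` to `ℝⁿ⁺¹` so as to be constant in the direction `eₙ₊₁`. -/
def cayleyPullback {n : ℕ} (g : Ambient n → Rn n → Cl n) (x : Rn n) (w : Ambient n) : Cl n :=
  weightJ x * g (cayley x) ((Rn n).orthogonalProjectionOnto (sandwich (shift x) w))

end

end CliffordSphere

open CliffordSphere

namespace CliffordSphere

open scoped Topology

noncomputable section

variable {n : ℕ} {k : ℕ}

/-! Write `s = x + eₙ₊₁`, `ρ = ‖s‖`, `y = C(x)`, and let `σ` be the reflection `w ↦ s w s / ρ²`.
Everything rests on `s σ(w) = -w s` (`vec_mul_vec_sandwich`) and on `C(x) = σ(eₙ₊₁)`, `dC = -(2/ρ²)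
σ` (`cayley_eq_sandwich`, `hasFDerivAt_cayley`).

The product rule splits `D_x F` into three terms. Differentiating the point `C(x)` gives `-2 J₋₁ y Λ
g`, because `D_s` can be computed in the orthonormal basis `σ(eⱼ)` (`sphereDirac_cayley`).
Differentiating the weight gives `-2 J₋₁ (n/2) y g` (`sum_vec_mul_fderiv_weightJ`). Differentiating
the reflected variable gives `2 J₋₁ u ∂ₓ g(y, u)`, with `∂ₓ` the derivative in `u` along `x`
(`sum_vec_sandwich_mul_fderiv_sandwich`). Hence `D_x F = -2 J₋₁ (D_s g - u ∂ₓ g)`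
(`diracX_cayleyPullback`).

The extra term lies in `u 𝓜_{k-1}`, so `P_k` kills it. Finally `q ↦ s q(σ w)` carries `𝓜_k(ℝⁿ)` into
`𝓜_k(H_x)` and `u 𝓜_{k-1}(ℝⁿ)` into `w 𝓜_{k-1}(H_x)`, hence commutes with `P_k`
(`IsMonogenicPart.comp_sandwichTo`); directness of the sum (`IsMonogenicPart.unique`) makes `P_k`
well defined. Both functions lie in the domain of `P_k` because a vector times an element of `𝓜_k`
does (`IsMonogenic.inFischerSpace_vec_mul`). -/

instance instFiniteDimensionalCl (n : ℕ) : FiniteDimensional ℝ (Cl n) :=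
  (clBasis n).finiteDimensional_of_finite

/-! ### Clifford algebra identities -/

theorem vec_mul_vec_add_swap {n : ℕ} (v w : Ambient n) :
    vec v * vec w + vec w * vec v = (-2 * inner ℝ v w) • (1 : Cl n) := by
  rw [vec, CliffordAlgebra.ι_mul_ι_add_swap, QuadraticMap.polar, negNormSq_apply,
    negNormSq_apply, negNormSq_apply, norm_add_sq_real, ← Algebra.algebraMap_eq_smul_one]
  congr 1
  ring

theorem vec_mul_vec_eq {n : ℕ} (v w : Ambient n) :
    vec v * vec w = (-2 * inner ℝ v w) • (1 : Cl n) - vec w * vec v :=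
  eq_sub_of_add_eq (vec_mul_vec_add_swap v w)

theorem vec_mul_self_eq_smul {n : ℕ} (v : Ambient n) :
    vec v * vec v = -(‖v‖ ^ 2) • (1 : Cl n) := by
  rw [vec_mul_self, Algebra.algebraMap_eq_smul_one]

theorem vec_mul_vec_mul_cancel {n : ℕ} (v : Ambient n) (a : Cl n) :
    vec v * (vec v * a) = -(‖v‖ ^ 2) • a := by
  rw [← mul_assoc, vec_mul_self_eq_smul, smul_mul_assoc, one_mul]

theorem sum_coord_smul {n : ℕ} (v : Ambient n) : ∑ j, v j • stdVec j = v := by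
  simpa [stdVec] using (EuclideanSpace.basisFun (Fin (n + 1)) ℝ).sum_repr v

theorem inner_stdVec {n : ℕ} (v : Ambient n) (j : Fin (n + 1)) : inner ℝ (stdVec j) v = v j := by
  simp [stdVec, EuclideanSpace.inner_single_left]

theorem inner_stdVec_right {n : ℕ} (v : Ambient n) (j : Fin (n + 1)) :
    inner ℝ v (stdVec j) = v j := by
  rw [real_inner_comm, inner_stdVec]

theorem norm_stdVec {n : ℕ} (j : Fin (n + 1)) : ‖(stdVec j : Ambient n)‖ = 1 := by
  simp [stdVec]

theorem sum_inner_smul {n : ℕ} (v : Ambient n) : ∑ j, inner ℝ v (stdVec j) • stdVec j = v := by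
  simp_rw [inner_stdVec_right]
  exact sum_coord_smul v

/-- The contraction `∑ⱼ eⱼ A(eⱼ)` of a linear map `A` with the identity of `ℝⁿ⁺¹`. -/
def clTrace {n : ℕ} : (Ambient n →ₗ[ℝ] Cl n) →ₗ[ℝ] Cl n where
  toFun A := ∑ j, vec (stdVec j) * A (stdVec j)
  map_add' A B := by simp [mul_add, Finset.sum_add_distrib]
  map_smul' c A := by simp [Finset.smul_sum]

theorem clTrace_apply {n : ℕ} (A : Ambient n →ₗ[ℝ] Cl n) :
    clTrace A = ∑ j, vec (stdVec j) * A (stdVec j) := rfl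

/-- The contraction may be computed in any orthonormal basis. -/
theorem sum_vec_map_mul {n : ℕ} (L : Ambient n ≃ₗᵢ[ℝ] Ambient n) (A : Ambient n →ₗ[ℝ] Cl n) :
    ∑ j, vec (L (stdVec j)) * A (L (stdVec j)) = clTrace A := by
  have h (j : Fin (n + 1)) : vec (L (stdVec j)) * A (L (stdVec j)) =
      ∑ i, vec (stdVec i) * A (L (inner ℝ (L.symm (stdVec i)) (stdVec j) • stdVec j)) := by
    conv_lhs => rw [← sum_coord_smul (L (stdVec j))]
    rw [map_sum vec, Finset.sum_mul, sum_coord_smul]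
    refine Finset.sum_congr rfl fun i _ => ?_
    rw [← inner_stdVec, map_smul, map_smul, map_smul, mul_smul_comm, smul_mul_assoc,
      ← L.inner_map_map (L.symm _), L.apply_symm_apply]
  simp_rw [h]
  rw [Finset.sum_comm, clTrace_apply]
  refine Finset.sum_congr rfl fun i _ => ?_
  rw [← Finset.mul_sum, ← map_sum, ← map_sum, sum_inner_smul, L.apply_symm_apply]

theorem sum_vec_mul_inner_smul {n : ℕ} (v : Ambient n) (a : Cl n) :
    ∑ j, vec (stdVec j) * (inner ℝ v (stdVec j) • a) = vec v * a := by
  simp_rw [mul_smul_comm, ← smul_mul_assoc, ← map_smul]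
  rw [← Finset.sum_mul, ← map_sum, sum_inner_smul]

/-- Moving a vector from the inside of the contraction to the outside. -/
theorem sum_vec_mul_vec_mul {n : ℕ} (v : Ambient n) (A : Ambient n →ₗ[ℝ] Cl n) :
    ∑ j, vec (stdVec j) * (vec v * A (stdVec j)) = -(vec v * clTrace A) - (2 : ℝ) • A v := by
  have h (j : Fin (n + 1)) : vec (stdVec j) * (vec v * A (stdVec j)) =
      -(vec v * (vec (stdVec j) * A (stdVec j))) -
        (2 : ℝ) • A (inner ℝ v (stdVec j) • stdVec j) := by
    rw [← mul_assoc, vec_mul_vec_eq, sub_mul, smul_mul_assoc, one_mul, mul_assoc, map_smul,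
      smul_smul, real_inner_comm, neg_mul, neg_smul]
    abel
  simp_rw [h]
  rw [Finset.sum_sub_distrib, Finset.sum_neg_distrib, ← Finset.mul_sum, ← Finset.smul_sum,
    ← map_sum, sum_inner_smul, clTrace_apply]

/-! ### Homogeneous polynomials -/

/-- In a basis the map is a finite sum of products of coordinates. This opens differential calculus
to `IsHomPoly`, which is purely algebraic. -/
theorem continuous_multilinearMap {k : ℕ} {E F : Type*} [NormedAddCommGroup E]
    [NormedSpace ℝ E] [FiniteDimensional ℝ E] [NormedAddCommGroup F] [NormedSpace ℝ F]
    (φ : MultilinearMap ℝ (fun _ : Fin k => E) F) : Continuous φ := by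
  let b := Module.finBasis ℝ E
  have h : (φ : (Fin k → E) → F) =
      fun m => ∑ r : Fin k → Fin (Module.finrank ℝ E),
        (∏ i, b.coord (r i) (m i)) • φ fun i => b (r i) := by
    funext m
    conv_lhs => rw [show m = fun i => ∑ j, b.repr (m i) j • b j from
      funext fun i => (b.sum_repr (m i)).symm]
    rw [MultilinearMap.map_sum]
    refine Finset.sum_congr rfl fun r _ => ?_
    rw [MultilinearMap.map_smul_univ]
    rfl
  rw [h]
  refine continuous_finsetSum _ fun r _ => Continuous.smul ?_ continuous_const
  exact continuous_finsetProd _ fun i _ =>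
    (LinearMap.continuous_of_finiteDimensional (b.coord (r i))).comp (continuous_apply i)

section Subspace

variable {H : Submodule ℝ (Ambient n)}

theorem IsHomPoly.exists_continuous {p : H → Cl n} (hp : IsHomPoly H k p) :
    ∃ φ : ContinuousMultilinearMap ℝ (fun _ : Fin k => H) (Cl n), p = fun w => φ fun _ => w := by
  obtain ⟨φ, hφ⟩ := hp
  exact ⟨⟨φ, continuous_multilinearMap φ⟩, funext hφ⟩

theorem IsHomPoly.contDiff {p : H → Cl n} (hp : IsHomPoly H k p) : ContDiff ℝ 2 p := by
  obtain ⟨φ, rfl⟩ := hp.exists_continuous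
  exact φ.contDiff.comp (contDiff_pi.2 fun _ => contDiff_id)

theorem IsHomPoly.differentiable {p : H → Cl n} (hp : IsHomPoly H k p) : Differentiable ℝ p :=
  hp.contDiff.differentiable (by norm_num)

theorem fderiv_multilinearMap_diagonal {E F : Type*} [NormedAddCommGroup E]
    [NormedSpace ℝ E] [NormedAddCommGroup F] [NormedSpace ℝ F]
    (φ : ContinuousMultilinearMap ℝ (fun _ : Fin k => E) F) (w v : E) :
    fderiv ℝ (fun w => φ fun _ => w) w v = ∑ i, φ (Function.update (fun _ => w) i v) := by
  have h : HasFDerivAt (fun w : E => (fun _ : Fin k => w))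
      (ContinuousLinearMap.pi fun _ => ContinuousLinearMap.id ℝ E) w :=
    hasFDerivAt_pi.2 fun _ => hasFDerivAt_id w
  have h2 := ((φ.hasFDerivAt (fun _ => w)).comp w h).fderiv
  rw [Function.comp_def] at h2
  rw [h2]
  simp [ContinuousMultilinearMap.linearDeriv_apply]

/-- Euler's formula. -/
theorem IsHomPoly.fderiv_self {p : H → Cl n} (hp : IsHomPoly H k p) (w : H) :
    fderiv ℝ p w w = (k : ℝ) • p w := by
  obtain ⟨φ, rfl⟩ := hp.exists_continuous
  rw [fderiv_multilinearMap_diagonal]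
  simp [Function.update_eq_self, Nat.cast_smul_eq_nsmul]

theorem IsHomPoly.fderiv_apply_zero {p : H → Cl n} (hp : IsHomPoly H 0 p) (w v : H) :
    fderiv ℝ p w v = 0 := by
  obtain ⟨φ, rfl⟩ := hp.exists_continuous
  rw [fderiv_multilinearMap_diagonal]
  simp

theorem IsHomPoly.fderiv_apply {p : H → Cl n} (hp : IsHomPoly H (k + 1) p) (v : H) :
    IsHomPoly H k fun w => fderiv ℝ p w v := by
  obtain ⟨φ, rfl⟩ := hp.exists_continuous
  refine ⟨∑ i, MultilinearMap.curryMid i φ.toMultilinearMap v, fun w => ?_⟩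
  beta_reduce
  rw [fderiv_multilinearMap_diagonal, sum_apply]
  refine Finset.sum_congr rfl fun i _ => ?_
  change _ = φ (i.insertNth v fun _ => w)
  congr 1
  ext j : 1
  refine Fin.succAboveCases i ?_ (fun j => ?_) j <;> simp

/-- The restriction of a multilinear map to the diagonal. -/
def diagonalMap (H : Submodule ℝ (Ambient n)) (k : ℕ) :
    MultilinearMap ℝ (fun _ : Fin k => H) (Cl n) →ₗ[ℝ] (H → Cl n) where
  toFun φ w := φ fun _ => w
  map_add' _ _ := rfl
  map_smul' c φ := by ext w; simp

/-- The homogeneous polynomials of degree `k`, as a space of functions. -/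
def homPolySubmodule (H : Submodule ℝ (Ambient n)) (k : ℕ) : Submodule ℝ (H → Cl n) :=
  LinearMap.range (diagonalMap H k)

theorem mem_homPolySubmodule {p : H → Cl n} : p ∈ homPolySubmodule H k ↔ IsHomPoly H k p := by
  rw [homPolySubmodule, LinearMap.mem_range]
  exact exists_congr fun φ => ⟨fun h w => (congrFun h w).symm, fun h => funext fun w => (h w).symm⟩

instance instFiniteDimensionalHomPolySubmodule : FiniteDimensional ℝ (homPolySubmodule H k) := by
  unfold homPolySubmodule; infer_instance

theorem IsHomPoly.const_mul {p : H → Cl n} (hp : IsHomPoly H k p) (a : Cl n) :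
    IsHomPoly H k fun w => a * p w := by
  obtain ⟨φ, h⟩ := hp
  exact ⟨(LinearMap.mulLeft ℝ a).compMultilinearMap φ, fun w => by simp [h]⟩

theorem IsHomPoly.comp_linear {H' : Submodule ℝ (Ambient n)} {p : H → Cl n}
    (hp : IsHomPoly H k p) (L : H' →ₗ[ℝ] H) : IsHomPoly H' k fun w => p (L w) := by
  obtain ⟨φ, h⟩ := hp
  exact ⟨φ.compLinearMap fun _ => L, fun w => by simp [h]⟩

/-- The product of a linear map and a homogeneous polynomial. -/
theorem IsHomPoly.linear_mul {p : H → Cl n} (hp : IsHomPoly H k p) (L : H →ₗ[ℝ] Cl n) :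
    IsHomPoly H (k + 1) fun w => L w * p w := by
  obtain ⟨φ, h⟩ := hp
  let A : H →ₗ[ℝ] MultilinearMap ℝ (fun _ : Fin k => H) (Cl n) :=
    { toFun := fun v => (LinearMap.mulLeft ℝ (L v)).compMultilinearMap φ
      map_add' := fun a b => by ext m; simp [add_mul]
      map_smul' := fun c a => by ext m; simp }
  refine ⟨LinearMap.uncurryLeft (M := fun _ => H) A, fun w => ?_⟩
  beta_reduce
  rw [h]
  rfl

/-! ### The Dirac operator of a subspace and its monogenic polynomials -/

theorem dirac_eq_clTrace (H : Submodule ℝ (Ambient n)) (p : H → Cl n) (w : H) :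
    dirac H p w =
      clTrace ((fderiv ℝ p w : H →ₗ[ℝ] Cl n) ∘ₗ (H.orthogonalProjectionOnto : Ambient n →ₗ[ℝ] H)) :=
  rfl

theorem dirac_add {p q : H → Cl n} {w : H} (hp : DifferentiableAt ℝ p w)
    (hq : DifferentiableAt ℝ q w) : dirac H (p + q) w = dirac H p w + dirac H q w := by
  simp [dirac, fderiv_add hp hq, mul_add, Finset.sum_add_distrib]

theorem dirac_const_smul {p : H → Cl n} {w : H} (hp : DifferentiableAt ℝ p w) (c : ℝ) :
    dirac H (c • p) w = c • dirac H p w := by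
  simp [dirac, fderiv_const_smul hp, Finset.smul_sum]

/-- The space `𝓜_k` as a space of functions. -/
def monogenicSubmodule (H : Submodule ℝ (Ambient n)) (k : ℕ) : Submodule ℝ (H → Cl n) where
  carrier := {p | IsMonogenic H k p}
  add_mem' {p q} hp hq := by
    refine ⟨mem_homPolySubmodule.1 (add_mem (mem_homPolySubmodule.2 hp.1)
      (mem_homPolySubmodule.2 hq.1)), fun w => ?_⟩
    rw [dirac_add (hp.1.differentiable w) (hq.1.differentiable w), hp.2, hq.2, add_zero]
  zero_mem' := ⟨mem_homPolySubmodule.1 (zero_mem _), fun w => by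
    have h : fderiv ℝ (0 : H → Cl n) w = 0 := fderiv_const_apply (0 : Cl n)
    simp [dirac, h]⟩
  smul_mem' c p hp := by
    refine ⟨mem_homPolySubmodule.1 (Submodule.smul_mem _ c (mem_homPolySubmodule.2 hp.1)),
      fun w => ?_⟩
    rw [dirac_const_smul (hp.1.differentiable w), hp.2, smul_zero]

theorem mem_monogenicSubmodule {p : H → Cl n} :
    p ∈ monogenicSubmodule H k ↔ IsMonogenic H k p := Iff.rfl

/-- Finite dimension gives closedness in the topology of pointwise convergence, so pointwise limits
of difference quotients stay in `𝓜_k`. -/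
theorem isClosed_monogenicSubmodule (H : Submodule ℝ (Ambient n)) (k : ℕ) :
    IsClosed (monogenicSubmodule H k : Set (H → Cl n)) := by
  have hle : monogenicSubmodule H k ≤ homPolySubmodule H k :=
    fun p hp => mem_homPolySubmodule.2 hp.1
  have := Submodule.finiteDimensional_of_le hle
  exact Submodule.closed_of_finiteDimensional _

/-- Directional derivatives of monogenic polynomials are monogenic. -/
theorem IsMonogenic.fderiv_apply {p : H → Cl n} (hp : IsMonogenic H (k + 1) p) (v : H) :
    IsMonogenic H k fun w => fderiv ℝ p w v := by
  refine ⟨hp.1.fderiv_apply v, fun w => ?_⟩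
  have hd : Differentiable ℝ (fderiv ℝ p) :=
    (hp.1.contDiff.fderiv_right (m := 1) (by norm_num)).differentiable (by norm_num)
  have hsymm (a b : H) : fderiv ℝ (fderiv ℝ p) w a b = fderiv ℝ (fderiv ℝ p) w b a :=
    second_derivative_symmetric (fun y => (hp.1.differentiable y).hasFDerivAt)
      (hd w).hasFDerivAt a b
  have happ (b : H) : HasFDerivAt (fun w => fderiv ℝ p w b)
      ((ContinuousLinearMap.apply ℝ (Cl n) b).comp (fderiv ℝ (fderiv ℝ p) w)) w :=
    HasFDerivAt.comp (f := fderiv ℝ p) (g := ContinuousLinearMap.apply ℝ (Cl n) b) w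
      (ContinuousLinearMap.hasFDerivAt _) (hd w).hasFDerivAt
  -- Differentiate the identity `D p = 0` along `v`; symmetry of the second derivative turns the
  -- result into `D (∂_v p) = 0`.
  have hzero : (fun w => ∑ j, LinearMap.toContinuousLinearMap
      (LinearMap.mulLeft ℝ (vec (stdVec (n := n) j)))
        (fderiv ℝ p w (H.orthogonalProjectionOnto (stdVec j)))) = fun _ => 0 :=
    funext hp.2
  have hder := HasFDerivAt.fun_sum (u := Finset.univ) fun j _ =>
    (LinearMap.toContinuousLinearMap
      (LinearMap.mulLeft ℝ (vec (stdVec (n := n) j)))).hasFDerivAt.comp w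
        (happ (H.orthogonalProjectionOnto (stdVec j)))
  simp only [Function.comp_def] at hder
  rw [hzero] at hder
  have h0 := DFunLike.congr_fun (hder.unique (hasFDerivAt_const (0 : Cl n) w)) v
  simp only [dirac, (happ v).fderiv]
  rw [sum_apply] at h0
  refine Eq.trans (Finset.sum_congr rfl fun j _ => ?_) h0
  simp [hsymm v]

/-- `w ∂_v p` lies in `w 𝓜_{k-1}` for `p ∈ 𝓜_k`. -/
theorem IsMonogenic.isVecMulMonogenic_fderiv {p : H → Cl n} (hp : IsMonogenic H k p) (v : H) :
    IsVecMulMonogenic H k fun w => vec (w : Ambient n) * fderiv ℝ p w v := by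
  cases k with
  | zero => exact fun w => by simp [hp.1.fderiv_apply_zero]
  | succ k => exact ⟨_, hp.fderiv_apply v, fun w => rfl⟩

/-! ### The Fischer decomposition: linearity, directness, and products with a vector -/

theorem IsVecMulMonogenic.add {p q : H → Cl n} (hp : IsVecMulMonogenic H k p)
    (hq : IsVecMulMonogenic H k q) : IsVecMulMonogenic H k (p + q) := by
  cases k with
  | zero => exact fun w => by rw [Pi.add_apply, hp w, hq w, add_zero]
  | succ k =>
    obtain ⟨p', hp', hp⟩ := hp
    obtain ⟨q', hq', hq⟩ := hq
    exact ⟨p' + q', (monogenicSubmodule H k).add_mem hp' hq', fun w => by simp [hp, hq, mul_add]⟩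

theorem IsVecMulMonogenic.const_smul {p : H → Cl n} (hp : IsVecMulMonogenic H k p) (c : ℝ) :
    IsVecMulMonogenic H k (c • p) := by
  cases k with
  | zero => exact fun w => by rw [Pi.smul_apply, hp w, smul_zero]
  | succ k =>
    obtain ⟨p', hp', hp⟩ := hp
    exact ⟨c • p', (monogenicSubmodule H k).smul_mem c hp', fun w => by simp [hp]⟩

theorem IsMonogenicPart.add {h₁ h₂ p₁ p₂ : H → Cl n} (hp : IsMonogenicPart H k h₁ p₁)
    (hq : IsMonogenicPart H k h₂ p₂) : IsMonogenicPart H k (h₁ + h₂) (p₁ + p₂) := by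
  refine ⟨(monogenicSubmodule H k).add_mem hp.1 hq.1, ?_⟩
  convert hp.2.add hq.2 using 1
  ext w
  simp only [Pi.add_apply]
  abel

theorem IsMonogenicPart.const_smul {h p : H → Cl n} (hp : IsMonogenicPart H k h p) (c : ℝ) :
    IsMonogenicPart H k (c • h) (c • p) := by
  refine ⟨(monogenicSubmodule H k).smul_mem c hp.1, ?_⟩
  convert hp.2.const_smul c using 1
  ext w
  simp only [Pi.smul_apply, smul_sub]

/-- The domain of `P_k` as a space of functions. -/
def fischerSubmodule (H : Submodule ℝ (Ambient n)) (k : ℕ) : Submodule ℝ (H → Cl n) where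
  carrier := {h | InFischerSpace H k h}
  add_mem' := fun ⟨_, hp⟩ ⟨_, hq⟩ => ⟨_, hp.add hq⟩
  zero_mem' := by
    refine ⟨0, (monogenicSubmodule H k).zero_mem, ?_⟩
    cases k with
    | zero => exact fun w => by simp
    | succ k => exact ⟨0, (monogenicSubmodule H k).zero_mem, fun w => by simp⟩
  smul_mem' c _ := fun ⟨_, hp⟩ => ⟨_, hp.const_smul c⟩

/-- The sum `∑ⱼ ‖Πeⱼ‖²`, the trace of the orthogonal projection onto `H`. -/
def projTrace (H : Submodule ℝ (Ambient n)) : ℝ :=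
  ∑ j, ‖H.orthogonalProjectionOnto (stdVec j)‖ ^ 2

theorem projTrace_nonneg (H : Submodule ℝ (Ambient n)) : 0 ≤ projTrace H :=
  Finset.sum_nonneg fun _ _ => sq_nonneg _

/-- The trace vanishes only for `H = 0`, the degenerate case of the Fischer decomposition; it occurs
for `ℝⁿ` when `n = 0`. -/
theorem eq_zero_of_projTrace_eq_zero (h : projTrace H = 0) (w : H) : w = 0 := by
  have h0 : ∀ j, H.orthogonalProjectionOnto (stdVec j) = 0 := fun j => norm_eq_zero.1 <|
    pow_eq_zero_iff two_ne_zero |>.1 <|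
      (Finset.sum_eq_zero_iff_of_nonneg fun _ _ => sq_nonneg _).1 h j (Finset.mem_univ j)
  rw [← H.orthogonalProjectionOnto_mem_subspace_eq_self w, ← sum_coord_smul (w : Ambient n),
    map_sum]
  exact Finset.sum_eq_zero fun j _ => by rw [map_smul, h0, smul_zero]

theorem inner_projection_stdVec (H : Submodule ℝ (Ambient n)) (v w : Ambient n) :
    inner ℝ (H.orthogonalProjectionOnto v : Ambient n) w =
      inner ℝ v (H.orthogonalProjectionOnto w : Ambient n) :=
  H.inner_starProjection_left_eq_right v w

/-- The projection is self-adjoint, so the two factors may be exchanged under the sum; averaging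
both orders leaves only the anticommutators, which are scalars. -/
theorem sum_vec_mul_vec_projection (H : Submodule ℝ (Ambient n)) :
    ∑ j, vec (stdVec j) * vec (H.orthogonalProjectionOnto (stdVec j) : Ambient n) =
      (-projTrace H) • (1 : Cl n) := by
  have h1 : ∑ j, vec (stdVec j) * vec (H.orthogonalProjectionOnto (stdVec j) : Ambient n) =
      ∑ j, vec (H.orthogonalProjectionOnto (stdVec j) : Ambient n) * vec (stdVec j) := by
    have e (j : Fin (n + 1)) : vec (H.orthogonalProjectionOnto (stdVec j) : Ambient n) =
        ∑ i, inner ℝ (stdVec j) (H.orthogonalProjectionOnto (stdVec i) : Ambient n) •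
          vec (stdVec i) := by
      simp_rw [← inner_projection_stdVec, ← map_smul]
      rw [← map_sum, sum_inner_smul]
    simp_rw [e, Finset.mul_sum, Finset.sum_mul, mul_smul_comm, smul_mul_assoc]
    rw [Finset.sum_comm]
    refine Finset.sum_congr rfl fun i _ => Finset.sum_congr rfl fun j _ => ?_
    rw [← inner_projection_stdVec, real_inner_comm]
  have h2 : (2 : ℝ) • ∑ j, vec (stdVec j) *
      vec (H.orthogonalProjectionOnto (stdVec j) : Ambient n) =
        (2 : ℝ) • (-projTrace H) • (1 : Cl n) := by
    rw [two_smul]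
    nth_rw 2 [h1]
    rw [← Finset.sum_add_distrib]
    simp_rw [vec_mul_vec_add_swap]
    rw [← Finset.sum_smul, smul_smul, projTrace, ← Finset.mul_sum]
    congr 1
    rw [neg_mul, mul_neg]
    congr 2
    refine Finset.sum_congr rfl fun j _ => ?_
    rw [← real_inner_self_eq_norm_sq, Submodule.coe_inner, inner_projection_stdVec,
      H.orthogonalProjectionOnto_mem_subspace_eq_self]
  exact smul_right_injective _ two_ne_zero h2

theorem hasFDerivAt_const_mul (a : Cl n) {E : Type*} [NormedAddCommGroup E] [NormedSpace ℝ E]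
    {p : E → Cl n} {p' : E →L[ℝ] Cl n} {w : E} (hp : HasFDerivAt p p' w) :
    HasFDerivAt (fun w => a * p w)
      ((LinearMap.toContinuousLinearMap (LinearMap.mulLeft ℝ a)).comp p') w :=
  (LinearMap.toContinuousLinearMap (LinearMap.mulLeft ℝ a)).hasFDerivAt.comp w hp

theorem dirac_vec_const_mul (v : Ambient n) {p : H → Cl n} {w : H} (hp : DifferentiableAt ℝ p w) :
    dirac H (fun w => vec v * p w) w =
      -(vec v * dirac H p w) - (2 : ℝ) • fderiv ℝ p w (H.orthogonalProjectionOnto v) := by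
  rw [dirac, (hasFDerivAt_const_mul (vec v) hp.hasFDerivAt).fderiv]
  exact sum_vec_mul_vec_mul v
    ((fderiv ℝ p w : H →ₗ[ℝ] Cl n) ∘ₗ (H.orthogonalProjectionOnto : Ambient n →ₗ[ℝ] H))

/-- Multiplication in `Clₙ₊₁` as a continuous bilinear map. -/
def clMul (n : ℕ) : Cl n →L[ℝ] Cl n →L[ℝ] Cl n :=
  LinearMap.toContinuousLinearMap
    ((LinearMap.toContinuousLinearMap : (Cl n →ₗ[ℝ] Cl n) ≃ₗ[ℝ] (Cl n →L[ℝ] Cl n)).toLinearMap ∘ₗ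
      LinearMap.mul ℝ (Cl n))

theorem clMul_apply (a b : Cl n) : clMul n a b = a * b := rfl

/-- Only the normed space structure of `Cl n` is used: in finite dimension the bilinear
multiplication is automatically continuous. -/
theorem fderiv_mul_apply {E : Type*} [NormedAddCommGroup E] [NormedSpace ℝ E]
    {p q : E → Cl n} {p' q' : E →L[ℝ] Cl n} {w : E} (hp : HasFDerivAt p p' w)
    (hq : HasFDerivAt q q' w) (v : E) :
    fderiv ℝ (fun w => p w * q w) w v = p w * q' v + p' v * q w := by
  have h := (clMul n).hasFDerivAt_of_bilinear hp hq
  simp only [clMul_apply] at h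
  rw [h.fderiv]
  simp [clMul_apply]

/-- The inclusion of `H` into `Clₙ₊₁`. -/
def vecOn (H : Submodule ℝ (Ambient n)) : H →L[ℝ] Cl n :=
  LinearMap.toContinuousLinearMap (vec ∘ₗ H.subtype)

/-- Differentiating the factor `w` contributes minus the trace of the projection. Moving `w` out of
the other contraction leaves `-w D q - 2 ∂_w q`, where `D q = 0` and Euler's formula gives `∂_w q =
k q`. -/
theorem IsMonogenic.dirac_vec_mul {q : H → Cl n} (hq : IsMonogenic H k q) (w : H) :
    dirac H (fun w => vec (w : Ambient n) * q w) w = (-(projTrace H + 2 * k)) • q w := by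
  have hd := hq.1.differentiable w
  have h (j : Fin (n + 1)) : vec (stdVec j) *
      fderiv ℝ (fun w : H => vec (w : Ambient n) * q w) w (H.orthogonalProjectionOnto (stdVec j)) =
      vec (stdVec j) * (vec (w : Ambient n) *
        fderiv ℝ q w (H.orthogonalProjectionOnto (stdVec j))) +
      vec (stdVec j) * vec (H.orthogonalProjectionOnto (stdVec j) : Ambient n) * q w := by
    change vec (stdVec j) * fderiv ℝ (fun w : H => vecOn H w * q w) w _ = _
    rw [fderiv_mul_apply (p := vecOn H) (vecOn H).hasFDerivAt hd.hasFDerivAt, mul_add, mul_assoc]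
    rfl
  have h2 := sum_vec_mul_vec_mul (w : Ambient n)
    ((fderiv ℝ q w : H →ₗ[ℝ] Cl n) ∘ₗ (H.orthogonalProjectionOnto : Ambient n →ₗ[ℝ] H))
  rw [← dirac_eq_clTrace, hq.2, mul_zero, neg_zero, zero_sub] at h2
  simp only [LinearMap.comp_apply, ContinuousLinearMap.coe_coe,
    H.orthogonalProjectionOnto_mem_subspace_eq_self, hq.1.fderiv_self] at h2
  rw [dirac]
  simp_rw [h]
  rw [Finset.sum_add_distrib, h2, ← Finset.sum_mul, sum_vec_mul_vec_projection, smul_mul_assoc,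
    one_mul, smul_smul, ← neg_smul, ← add_smul]
  congr 1
  ring

/-- The sum `𝓜_k + w 𝓜_{k-1}` is direct. -/
theorem IsVecMulMonogenic.eq_zero_of_isMonogenic {p : H → Cl n} (h : IsVecMulMonogenic H k p)
    (hp : IsMonogenic H k p) : p = 0 := by
  cases k with
  | zero => exact funext h
  | succ k =>
    obtain ⟨q, hq, hpq⟩ := h
    have hpq' : p = fun w : H => vec (w : Ambient n) * q w := funext hpq
    ext w
    rw [hpq]
    -- If the factor vanishes then `H = 0`, so `w = 0`; otherwise monogenicity of `w q` forces `q =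
    -- 0`.
    by_cases h0 : projTrace H + 2 * k = 0
    · have h1 : projTrace H = 0 := by
        have := projTrace_nonneg H
        have : (0 : ℝ) ≤ k := Nat.cast_nonneg k
        linarith
      simp [eq_zero_of_projTrace_eq_zero h1 w]
    · have h1 := hp.2 w
      rw [hpq', hq.dirac_vec_mul, smul_eq_zero] at h1
      rw [h1.resolve_left (neg_ne_zero.2 h0), mul_zero, Pi.zero_apply]

theorem IsMonogenicPart.unique {h p q : H → Cl n} (hp : IsMonogenicPart H k h p)
    (hq : IsMonogenicPart H k h q) : p = q := by
  have h1 : IsMonogenic H k (p - q) := (monogenicSubmodule H k).sub_mem hp.1 hq.1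
  have h2 : IsVecMulMonogenic H k (p - q) := by
    convert hq.2.add (hp.2.const_smul (-1)) using 1
    ext w
    simp
  exact sub_eq_zero.1 (h2.eq_zero_of_isMonogenic h1)

theorem InFischerSpace.isMonogenicPart {h : H → Cl n} (hh : InFischerSpace H k h) :
    IsMonogenicPart H k h (projMonogenic H k h) := by
  rw [projMonogenic, dif_pos hh]
  exact Classical.choose_spec hh

theorem IsMonogenicPart.projMonogenic_eq {h p : H → Cl n} (hp : IsMonogenicPart H k h p) :
    projMonogenic H k h = p :=
  (InFischerSpace.isMonogenicPart ⟨p, hp⟩).unique hp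

theorem IsMonogenic.vec_const_mul_zero {p : H → Cl n} (hp : IsMonogenic H k p) {v : Ambient n}
    (hv : ∀ w, fderiv ℝ p w (H.orthogonalProjectionOnto v) = 0) :
    IsMonogenic H k fun w => vec v * p w :=
  ⟨hp.1.const_mul _, fun w => by
    rw [dirac_vec_const_mul v (hp.1.differentiable w), hp.2, hv, mul_zero, neg_zero, smul_zero,
      sub_zero]⟩

/-- The Fischer decomposition of `v p`, for a vector `v` and `p ∈ 𝓜_k`. -/
theorem IsMonogenic.inFischerSpace_vec_mul {p : H → Cl n} (hp : IsMonogenic H k p)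
    (v : Ambient n) : InFischerSpace H k fun w => vec v * p w := by
  by_cases hv : ∀ w, fderiv ℝ p w (H.orthogonalProjectionOnto v) = 0
  -- Here `v p` is itself monogenic. The zero remainder is obtained as `0` times the remainder of a
  -- decomposition of the zero function.
  · exact ⟨_, hp.vec_const_mul_zero hv, by
      convert ((fischerSubmodule H k).zero_mem).choose_spec.2.const_smul 0 using 1
      ext w
      simp⟩
  cases k with
  | zero => exact absurd (fun w => hp.1.fderiv_apply_zero w _) hv
  | succ k =>
    have hq := hp.fderiv_apply (H.orthogonalProjectionOnto v)
    set q := fun w => fderiv ℝ p w (H.orthogonalProjectionOnto v) with hqdef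
    have hne : projTrace H + 2 * k ≠ 0 := fun h0 => hv fun w => by
      have h1 : projTrace H = 0 := by
        have := projTrace_nonneg H
        have : (0 : ℝ) ≤ k := Nat.cast_nonneg k
        linarith
      rw [eq_zero_of_projTrace_eq_zero h1 (H.orthogonalProjectionOnto v), map_zero]
    -- Since `D(v p) = -2 q` and `D(w q) = -(projTrace H + 2k) q`, this is the constant for which `v
    -- p - c w q` is monogenic.
    set c : ℝ := 2 / (projTrace H + 2 * k) with hc
    have hwq : IsHomPoly H (k + 1) fun w : H => vec (w : Ambient n) * q w :=
      hq.1.linear_mul (vec ∘ₗ H.subtype)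
    refine ⟨(fun w => vec v * p w) + (-c) • fun w : H => vec (w : Ambient n) * q w,
      ⟨?_, fun w => ?_⟩, c • q, (monogenicSubmodule H k).smul_mem c hq, fun w => ?_⟩
    · exact mem_homPolySubmodule.1 (add_mem (mem_homPolySubmodule.2 (hp.1.const_mul _))
        (Submodule.smul_mem _ _ (mem_homPolySubmodule.2 hwq)))
    · rw [dirac_add ((hp.1.const_mul _).differentiable w)
        ((hwq.differentiable w).const_smul _), dirac_const_smul (hwq.differentiable w),
        hq.dirac_vec_mul, dirac_vec_const_mul v (hp.1.differentiable w), hp.2, smul_smul,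
        mul_zero, neg_zero, zero_sub, neg_mul_neg, hc, div_mul_cancel₀ _ hne]
      exact neg_add_cancel _
    · simp

end Subspace

/-! ### Reflections -/

theorem sandwich_apply (y w : Ambient n) : sandwich y w = (ℝ ∙ y)ᗮ.reflection w := rfl

theorem sandwich_sandwich (y w : Ambient n) : sandwich y (sandwich y w) = w :=
  (ℝ ∙ y)ᗮ.reflection_reflection w

theorem inner_sandwich_sandwich (y v w : Ambient n) :
    inner ℝ (sandwich y v) (sandwich y w) = inner ℝ v w :=
  (ℝ ∙ y)ᗮ.reflection.inner_map_map v w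

theorem inner_sandwich_left (y v w : Ambient n) :
    inner ℝ (sandwich y v) w = inner ℝ v (sandwich y w) := by
  rw [← inner_sandwich_sandwich y, sandwich_sandwich]

theorem sandwich_self (y : Ambient n) : sandwich y y = -y :=
  Submodule.reflection_orthogonalComplement_singleton_eq_neg y

/-- In this form the dependence on `y` is a linear factor times the inversion, so it can be
differentiated in `y`. -/
theorem sandwich_eq_add_vecInv (y w : Ambient n) :
    sandwich y w = w + (2 * inner ℝ y w) • vecInv y := by
  rw [sandwich_apply, Submodule.reflection_orthogonal_apply,
    Submodule.reflection_singleton_apply, vecInv]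
  simp only [RCLike.ofReal_real_eq_id, id, neg_sub, ← Nat.cast_smul_eq_nsmul ℝ, smul_smul, smul_neg]
  rw [sub_eq_add_neg]
  norm_num
  congr 1
  ring

/-- Multiply `y w y = ‖y‖² σ(w)` on the left by `y` and use `y² = -‖y‖²`. -/
theorem vec_mul_vec_sandwich (y w : Ambient n) :
    vec y * vec (sandwich y w) = -(vec w * vec y) := by
  rcases eq_or_ne y 0 with rfl | hy
  · simp
  have hy2 : ‖y‖ ^ 2 ≠ 0 := by simpa using hy
  have h := congrArg (fun a => vec y * a) (vec_sandwich y w)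
  simp only [mul_assoc, vec_mul_vec_mul_cancel, mul_smul_comm] at h
  rw [neg_smul, ← smul_neg] at h
  exact (smul_right_injective _ hy2 h).symm

/-! ### Monogenic polynomials and reflections -/

/-- The reflection as a map from the preimage of `K` to `K`. -/
def sandwichTo (y : Ambient n) (K : Submodule ℝ (Ambient n)) : K.comap (sandwich y) →L[ℝ] K :=
  LinearMap.toContinuousLinearMap
    ((sandwich y ∘ₗ (K.comap (sandwich y)).subtype).codRestrict K fun w => w.2)

theorem coe_sandwichTo (y : Ambient n) (K : Submodule ℝ (Ambient n))
    (w : K.comap (sandwich y)) : (sandwichTo y K w : Ambient n) = sandwich y w := rfl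

/-- The reflection is an isometric involution that exchanges the two subspaces, hence also their
orthogonal projections. -/
theorem sandwichTo_projection (y : Ambient n) (K : Submodule ℝ (Ambient n)) (v : Ambient n) :
    sandwichTo y K ((K.comap (sandwich y)).orthogonalProjectionOnto v) =
      K.orthogonalProjectionOnto (sandwich y v) := by
  refine Subtype.ext (Submodule.eq_starProjection_of_mem_of_inner_eq_zero
    (Subtype.property _) fun w hw => ?_).symm
  rw [coe_sandwichTo, ← map_sub, inner_sandwich_left]
  refine (K.comap (sandwich y)).starProjection_inner_eq_zero v _ ?_
  rwa [Submodule.mem_comap, sandwich_sandwich]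

/-- The Dirac operator intertwines with `q ↦ y q(y w y / ‖y‖²)`. -/
theorem dirac_vec_mul_comp_sandwichTo (y : Ambient n) (K : Submodule ℝ (Ambient n)) {q : K → Cl n}
    (hq : Differentiable ℝ q) (w : K.comap (sandwich y)) :
    dirac (K.comap (sandwich y)) (fun w => vec y * q (sandwichTo y K w)) w =
      -(vec y * dirac K q (sandwichTo y K w)) := by
  have hd := hasFDerivAt_const_mul (vec y)
    ((hq (sandwichTo y K w)).hasFDerivAt.comp w (sandwichTo y K).hasFDerivAt)
  simp only [Function.comp_apply] at hd
  -- On the right the contraction is taken in the orthonormal basis `σ(eⱼ)`; then `eⱼ y = -y σ(eⱼ)`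
  -- matches the sums term by term.
  rw [dirac, hd.fderiv, dirac_eq_clTrace, ← sum_vec_map_mul (ℝ ∙ y)ᗮ.reflection, Finset.mul_sum,
    ← Finset.sum_neg_distrib]
  refine Finset.sum_congr rfl fun j _ => ?_
  simp only [ContinuousLinearMap.comp_apply, sandwichTo_projection, LinearMap.comp_apply,
    ContinuousLinearMap.coe_coe, LinearMap.coe_toContinuousLinearMap', LinearMap.mulLeft_apply,
    ← sandwich_apply]
  rw [← mul_assoc, ← mul_assoc, vec_mul_vec_sandwich, neg_mul, neg_neg]

theorem IsMonogenic.comp_sandwichTo {K : Submodule ℝ (Ambient n)} {q : K → Cl n}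
    (hq : IsMonogenic K k q) (y : Ambient n) :
    IsMonogenic (K.comap (sandwich y)) k fun w => vec y * q (sandwichTo y K w) :=
  ⟨(hq.1.comp_linear (sandwichTo y K).toLinearMap).const_mul (vec y), fun w => by
    rw [dirac_vec_mul_comp_sandwichTo y K hq.1.differentiable, hq.2, mul_zero, neg_zero]⟩

/-- By `y σ(w) = -w y`, the inner vector factor reappears on the left as `w`; this is where the sign
`-1` of the witness comes from. -/
theorem IsVecMulMonogenic.comp_sandwichTo {K : Submodule ℝ (Ambient n)} {q : K → Cl n}
    (hq : IsVecMulMonogenic K k q) (y : Ambient n) :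
    IsVecMulMonogenic (K.comap (sandwich y)) k fun w => vec y * q (sandwichTo y K w) := by
  cases k with
  | zero => exact fun w => by simp [hq _]
  | succ k =>
    obtain ⟨r, hr, hqr⟩ := hq
    refine ⟨_, (monogenicSubmodule _ k).smul_mem (-1) (hr.comp_sandwichTo y), fun w => ?_⟩
    beta_reduce
    rw [hqr, coe_sandwichTo, ← mul_assoc, vec_mul_vec_sandwich, Pi.smul_apply, mul_smul_comm,
      neg_one_smul, neg_mul, mul_assoc]

theorem IsMonogenicPart.comp_sandwichTo {K : Submodule ℝ (Ambient n)} {h p : K → Cl n}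
    (hp : IsMonogenicPart K k h p) (y : Ambient n) :
    IsMonogenicPart (K.comap (sandwich y)) k (fun w => vec y * h (sandwichTo y K w))
      fun w => vec y * p (sandwichTo y K w) := by
  refine ⟨hp.1.comp_sandwichTo y, ?_⟩
  simp_rw [← mul_sub]
  exact hp.2.comp_sandwichTo y

/-! ### The hyperplane `ℝⁿ` and the Cayley transformation -/

theorem norm_eLast : ‖eLast n‖ = 1 := norm_stdVec _

theorem inner_eLast_of_mem {v : Ambient n} (hv : v ∈ Rn n) : inner ℝ (eLast n) v = 0 := by
  induction hv using Submodule.span_induction with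
  | mem v hv =>
    obtain ⟨i, rfl⟩ := hv
    rw [eLast, inner_stdVec]
    simp [stdVec, (Fin.castSucc_lt_last i).ne']
  | zero => simp
  | add v w _ _ hv hw => rw [inner_add_right, hv, hw, add_zero]
  | smul c v _ hv => rw [inner_smul_right, hv, mul_zero]

theorem sub_inner_smul_eLast_mem (v : Ambient n) : v - inner ℝ (eLast n) v • eLast n ∈ Rn n := by
  rw [eLast, inner_stdVec]
  nth_rw 1 [← sum_coord_smul v]
  rw [Fin.sum_univ_castSucc, add_sub_cancel_right]
  exact Submodule.sum_mem _ fun i _ => Submodule.smul_mem _ _ (Submodule.subset_span ⟨i, rfl⟩)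

theorem coe_projection_Rn (v : Ambient n) :
    ((Rn n).orthogonalProjectionOnto v : Ambient n) = v - inner ℝ (eLast n) v • eLast n := by
  refine Submodule.eq_starProjection_of_mem_of_inner_eq_zero (sub_inner_smul_eLast_mem v)
    fun w hw => ?_
  rw [sub_sub_cancel, inner_smul_left, inner_eLast_of_mem hw, mul_zero]

theorem projection_eLast : (Rn n).orthogonalProjectionOnto (eLast n) = 0 := by
  ext1
  rw [coe_projection_Rn, real_inner_self_eq_norm_sq, norm_eLast]
  simp

theorem projection_shift (x : Rn n) : (Rn n).orthogonalProjectionOnto (shift x) = x := by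
  rw [shift, map_add, projection_eLast, add_zero,
    Submodule.orthogonalProjectionOnto_mem_subspace_eq_self]

theorem projTrace_Rn : projTrace (Rn n) = n := by
  rw [projTrace, Fin.sum_univ_castSucc]
  have h1 (i : Fin n) :
      ‖(Rn n).orthogonalProjectionOnto (stdVec i.castSucc)‖ = 1 := by
    rw [Submodule.norm_orthogonalProjectionOnto_apply (K := Rn n) (Submodule.subset_span ⟨i, rfl⟩),
      norm_stdVec]
  have h2 : (Rn n).orthogonalProjectionOnto (stdVec (Fin.last n)) = 0 := projection_eLast
  simp [h1, h2]

theorem inner_shift_eLast (x : Rn n) : inner ℝ (shift x) (eLast n) = 1 := by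
  rw [shift, inner_add_left, real_inner_self_eq_norm_sq, norm_eLast, real_inner_comm,
    inner_eLast_of_mem x.2]
  norm_num

/-- Since `⟨x + eₙ₊₁, eₙ₊₁⟩ = 1`, the reflection formula is exactly the Cayley formula. It follows
that `C(x)` is a unit vector, normal to `H_x`. -/
theorem cayley_eq_sandwich (x : Rn n) : cayley x = sandwich (shift x) (eLast n) := by
  rw [sandwich_eq_add_vecInv, inner_shift_eLast, mul_one, cayley]

theorem norm_cayley (x : Rn n) : ‖cayley x‖ = 1 := by
  rw [cayley_eq_sandwich, sandwich_apply, LinearIsometryEquiv.norm_map, norm_eLast]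

theorem cayley_sub_eLast (x : Rn n) :
    cayley x - eLast n = (-(2 / ‖shift x‖ ^ 2)) • shift x := by
  rw [cayley, add_sub_cancel_left, vecInv, smul_neg, smul_smul, neg_smul, div_eq_mul_inv]

theorem norm_shift_ne_zero (x : Rn n) : ‖shift x‖ ≠ 0 := norm_ne_zero_iff.2 (shift_ne_zero x)

theorem cayley_ne_eLast (x : Rn n) : cayley x - eLast n ≠ 0 := by
  rw [cayley_sub_eLast]
  have h := norm_shift_ne_zero x
  exact smul_ne_zero (neg_ne_zero.2 (div_ne_zero two_ne_zero (pow_ne_zero 2 h))) (shift_ne_zero x)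

theorem projection_cayley (x : Rn n) :
    (Rn n).orthogonalProjectionOnto (cayley x) = (-(2 / ‖shift x‖ ^ 2)) • x := by
  have h := congrArg (Rn n).orthogonalProjectionOnto (cayley_sub_eLast x)
  rwa [map_sub, map_smul, projection_eLast, projection_shift, sub_zero] at h

theorem inner_cayley (x u : Rn n) :
    inner ℝ (cayley x) (u : Ambient n) =
      (-(2 / ‖shift x‖ ^ 2)) * inner ℝ (shift x) (u : Ambient n) := by
  rw [← real_inner_smul_left, ← cayley_sub_eLast, inner_sub_left, inner_eLast_of_mem u.2, sub_zero]

/-- The inverse of the Cayley transformation, composed with the radial projection to the sphere. -/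
def cayleyInv (v : Ambient n) : Rn n :=
  (Rn n).orthogonalProjectionOnto
    ((-2 * (‖‖v‖⁻¹ • v - eLast n‖ ^ 2)⁻¹) • (‖v‖⁻¹ • v - eLast n))

theorem cayleyInv_cayley (x : Rn n) : cayleyInv (cayley x) = x := by
  have h := norm_shift_ne_zero x
  rw [cayleyInv, norm_cayley, inv_one, one_smul, cayley_sub_eLast, norm_smul, smul_smul, map_smul,
    projection_shift, Real.norm_eq_abs, mul_pow, sq_abs]
  have : (-2 * ((-(2 / ‖shift x‖ ^ 2)) ^ 2 * ‖shift x‖ ^ 2)⁻¹ * -(2 / ‖shift x‖ ^ 2)) = 1 := by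
    field_simp
  rw [this, one_smul]

theorem cayley_cayleyInv {v : Ambient n} (hv : v ≠ 0) (hv' : ‖v‖⁻¹ • v - eLast n ≠ 0) :
    cayley (cayleyInv v) = ‖v‖⁻¹ • v := by
  have hnv : ‖v‖ ≠ 0 := norm_ne_zero_iff.2 hv
  have hN : ‖‖v‖⁻¹ • v‖ = 1 := by
    rw [norm_smul, norm_inv, norm_norm, inv_mul_cancel₀ hnv]
  set N := ‖v‖⁻¹ • v with hNdef
  have hd : ‖N - eLast n‖ ≠ 0 := norm_ne_zero_iff.2 hv'
  -- For unit vectors this holds by expansion; it says that the inverted vector in `hs` has last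
  -- coordinate `1`, as a shift must.
  have hd2 : ‖N - eLast n‖ ^ 2 = -2 * inner ℝ (eLast n) (N - eLast n) := by
    rw [norm_sub_sq_real, hN, norm_eLast, inner_sub_right, real_inner_self_eq_norm_sq, norm_eLast,
      real_inner_comm]
    ring
  have hs : shift (cayleyInv v) = (-2 * (‖N - eLast n‖ ^ 2)⁻¹) • (N - eLast n) := by
    rw [shift, cayleyInv, coe_projection_Rn, ← hNdef, inner_smul_right]
    have : -2 * (‖N - eLast n‖ ^ 2)⁻¹ * inner ℝ (eLast n) (N - eLast n) = 1 := by
      rw [mul_right_comm, ← hd2]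
      exact mul_inv_cancel₀ (pow_ne_zero 2 hd)
    rw [this, one_smul, sub_add_cancel]
  rw [cayley, vecInv, hs, norm_smul, smul_smul, mul_pow, Real.norm_eq_abs, sq_abs, smul_neg,
    smul_smul, ← neg_smul]
  have : -(2 * (((-2 * (‖N - eLast n‖ ^ 2)⁻¹) ^ 2 * ‖N - eLast n‖ ^ 2)⁻¹ *
      (-2 * (‖N - eLast n‖ ^ 2)⁻¹))) = 1 := by
    field_simp
  rw [this, one_smul, add_sub_cancel]

theorem hasFDerivAt_shift (x : Rn n) : HasFDerivAt shift (Rn n).subtypeL x :=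
  (Rn n).subtypeL.hasFDerivAt.add_const (eLast n)

/-- Inversion is conformal, with a reflection as the orthogonal part of its derivative; the
derivative of `cayley` inherits this. -/
theorem hasFDerivAt_vecInv {s : Ambient n} (hs : s ≠ 0) :
    HasFDerivAt vecInv
      ((-(‖s‖ ^ 2)⁻¹) • LinearMap.toContinuousLinearMap (sandwich s)) s := by
  have hs2 : ‖s‖ ^ 2 ≠ 0 := by simpa using hs
  have h1 := (hasStrictFDerivAt_norm_sq s).hasFDerivAt
  have h2 := (((hasDerivAt_inv hs2).comp_hasFDerivAt s h1).smul (hasFDerivAt_id s)).neg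
  refine h2.congr_fderiv ?_
  ext1 h
  simp [sandwich_eq_add_vecInv, vecInv, smul_smul]
  rw [add_comm]
  congr 2
  ring

theorem hasFDerivAt_cayley (x : Rn n) :
    HasFDerivAt cayley
      ((-(2 / ‖shift x‖ ^ 2)) • (LinearMap.toContinuousLinearMap (sandwich (shift x))).comp
        (Rn n).subtypeL) x := by
  have h := ((((hasFDerivAt_vecInv (shift_ne_zero x)).comp x
    (hasFDerivAt_shift x)).const_smul (2 : ℝ)).const_add (eLast n))
  refine h.congr_fderiv ?_
  ext1 v
  simp [smul_smul, div_eq_mul_inv]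

/-- The derivative of the reflection of a fixed vector with respect to the point. -/
theorem hasFDerivAt_sandwich_shift (x : Rn n) (w : Ambient n) :
    HasFDerivAt (fun z : Rn n => sandwich (shift z) w)
      (LinearMap.toContinuousLinearMap
        ((-(2 / ‖shift x‖ ^ 2)) •
          ((innerₗ (Ambient n) w).smulRight (shift x) +
            inner ℝ (shift x) w • sandwich (shift x))) ∘L (Rn n).subtypeL) x := by
  have h1 := (((innerSL ℝ w).hasFDerivAt.comp x (hasFDerivAt_shift x)).const_smul (2 : ℝ)).smul
    ((hasFDerivAt_vecInv (shift_ne_zero x)).comp x (hasFDerivAt_shift x))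
  have h2 := h1.const_add w
  have he : (fun z : Rn n => sandwich (shift z) w) =
      fun z => w + (2 * inner ℝ w (shift z)) • vecInv (shift z) := by
    funext z
    rw [sandwich_eq_add_vecInv, real_inner_comm]
  rw [he]
  refine HasFDerivAt.congr_fderiv h2 ?_
  ext1 v
  simp only [Function.comp_apply, vecInv, real_inner_comm w (shift x)]
  simp [smul_smul]
  module

theorem differentiableAt_cayleyInv (x : Rn n) :
    DifferentiableAt ℝ (cayleyInv (n := n)) (cayley x) := by
  have h1 : ‖cayley x‖ ≠ 0 := by rw [norm_cayley]; exact one_ne_zero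
  have h0 : cayley x ≠ 0 := norm_ne_zero_iff.1 h1
  have hN : DifferentiableAt ℝ (fun v : Ambient n => ‖v‖⁻¹ • v - eLast n) (cayley x) :=
    (((differentiableAt_id.norm ℝ h0).inv h1).smul differentiableAt_id).sub_const _
  have h2 : ‖cayley x‖⁻¹ • cayley x - eLast n ≠ 0 := by
    rw [norm_cayley, inv_one, one_smul]
    exact cayley_ne_eLast x
  have h3 := ((hN.norm_sq ℝ).inv (pow_ne_zero 2 (norm_ne_zero_iff.2 h2))).const_mul (-2)
  exact (Rn n).orthogonalProjectionOnto.differentiableAt.comp _ (h3.smul hN)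

/-- The space splits as `σ(ℝⁿ) ⊕ ℝ C(x)`. On the first summand the chain rule for `cayleyInv ∘
cayley = id` decides; on the second the derivative is zero, since `cayleyInv` is constant along
rays. -/
theorem fderiv_cayleyInv (x : Rn n) (v : Ambient n) :
    fderiv ℝ cayleyInv (cayley x) v =
      (-(‖shift x‖ ^ 2 / 2)) • (Rn n).orthogonalProjectionOnto (sandwich (shift x) v) := by
  have hd := (differentiableAt_cayleyInv x).hasFDerivAt
  have hρ := norm_shift_ne_zero x
  have h1 (a : Rn n) : fderiv ℝ cayleyInv (cayley x) (sandwich (shift x) a) =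
      (-(‖shift x‖ ^ 2 / 2)) • a := by
    have h := hd.comp x (hasFDerivAt_cayley x)
    rw [show cayleyInv ∘ cayley = (id : Rn n → Rn n) from funext cayleyInv_cayley] at h
    have h' := DFunLike.congr_fun (h.unique (hasFDerivAt_id x)) a
    simp only [ContinuousLinearMap.comp_apply, smul_apply, map_smul,
      ContinuousLinearMap.id_apply] at h'
    have h'' := congrArg (fun b => (-(‖shift x‖ ^ 2 / 2)) • b) h'
    simp only [smul_smul] at h''
    rw [show -(‖shift x‖ ^ 2 / 2) * -(2 / ‖shift x‖ ^ 2) = 1 by field_simp, one_smul] at h''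
    exact h''
  have h2 : fderiv ℝ cayleyInv (cayley x) (cayley x) = 0 := by
    have hline : HasDerivAt (fun t : ℝ => t • cayley x) (cayley x) 1 := by
      simpa using (hasDerivAt_id (1 : ℝ)).smul_const (cayley x)
    have h := HasFDerivAt.comp_hasDerivAt (1 : ℝ) (l := cayleyInv)
      (l' := fderiv ℝ cayleyInv (cayley x)) (by rwa [one_smul]) hline
    have hc : cayleyInv ∘ (fun t : ℝ => t • cayley x) =ᶠ[𝓝 1] fun _ => cayleyInv (cayley x) := by
      filter_upwards [lt_mem_nhds (zero_lt_one (α := ℝ))] with t ht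
      have : ‖t • cayley x‖⁻¹ • t • cayley x = ‖cayley x‖⁻¹ • cayley x := by
        rw [norm_smul, Real.norm_of_nonneg ht.le, smul_smul, mul_inv_rev, mul_assoc,
          inv_mul_cancel₀ ht.ne', mul_one]
      rw [Function.comp_apply, cayleyInv, this]
      rfl
    exact (h.congr_of_eventuallyEq hc.symm).unique (hasDerivAt_const _ _)
  have hv : v = sandwich (shift x)
        ((Rn n).orthogonalProjectionOnto (sandwich (shift x) v) : Ambient n) +
      inner ℝ (eLast n) (sandwich (shift x) v) • cayley x := by
    rw [coe_projection_Rn, cayley_eq_sandwich, ← map_smul, ← map_add, sub_add_cancel,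
      sandwich_sandwich]
  conv_lhs => rw [hv]
  rw [map_add, map_smul, h2, smul_zero, add_zero, h1]

/-! ### The Dirac operator of the sphere in Cayley coordinates -/

/-- Antisymmetry of `eᵢ eⱼ` turns the sum over `i < j` into one over `i ≠ j`. Completing it with the
diagonal produces `y ∑ eⱼ S(eⱼ)`, and `eᵢ² = -1` accounts for the correction `S(y)`, which vanishes
for radial extensions. -/
theorem sum_Ioi_vec_mul_vec (y : Ambient n) (S : Ambient n →ₗ[ℝ] Cl n) :
    ∑ i : Fin (n + 1), ∑ j ∈ Finset.Ioi i,
      vec (stdVec i) * vec (stdVec j) * (y i • S (stdVec j) - y j • S (stdVec i)) =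
        vec y * clTrace S + S y := by
  have h1 (i j : Fin (n + 1)) (hij : j ∈ Finset.Ioi i) :
      vec (stdVec i) * vec (stdVec j) * (y i • S (stdVec j) - y j • S (stdVec i)) =
        y j • (vec (stdVec j) * vec (stdVec i) * S (stdVec i)) +
          y i • (vec (stdVec i) * vec (stdVec j) * S (stdVec j)) := by
    have h : vec (stdVec (n := n) i) * vec (stdVec j) = -(vec (stdVec j) * vec (stdVec i)) := by
      rw [vec_mul_vec_eq, inner_stdVec]
      simp [stdVec, (Finset.mem_Ioi.1 hij).ne]
    rw [mul_sub, mul_smul_comm, mul_smul_comm, h, neg_mul, neg_mul, smul_neg, smul_neg]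
    abel
  rw [Finset.sum_congr rfl fun i _ => Finset.sum_congr rfl (h1 i),
    Finset.sum_sum_Ioi_add_eq_sum_sum_off_diag
      (fun i j => y i • (vec (stdVec i) * vec (stdVec j) * S (stdVec j)))]
  have h2 (i : Fin (n + 1)) : ∑ j ∈ {i}ᶜ, y j • (vec (stdVec j) * vec (stdVec i) * S (stdVec i)) =
      vec y * (vec (stdVec i) * S (stdVec i)) + S (y i • stdVec i) := by
    have h3 : vec y * (vec (stdVec i) * S (stdVec i)) =
        ∑ j, y j • (vec (stdVec j) * vec (stdVec i) * S (stdVec i)) := by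
      conv_lhs => rw [← sum_coord_smul y]
      rw [map_sum, Finset.sum_mul]
      exact Finset.sum_congr rfl fun j _ => by rw [map_smul, smul_mul_assoc, mul_assoc]
    rw [h3, Fintype.sum_eq_add_sum_compl i, vec_mul_self_eq_smul, norm_stdVec, map_smul]
    simp
  rw [Finset.sum_congr rfl fun i _ => h2 i, Finset.sum_add_distrib, ← Finset.mul_sum, ← map_sum,
    sum_coord_smul, clTrace_apply]

/-- Near `C(x)` the extension of degree `0` is `(f ∘ C) ∘ C⁻¹`, where `cayleyInv` already includes
the radial projection; so differentiability of `f ∘ C` suffices. -/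
theorem hasFDerivAt_radial_of_cayley {f : Ambient n → Cl n} {x : Rn n} {A : Rn n →L[ℝ] Cl n}
    (hf : HasFDerivAt (fun z => f (cayley z)) A x) :
    HasFDerivAt (fun v : Ambient n => f (‖v‖⁻¹ • v))
      (A.comp (fderiv ℝ cayleyInv (cayley x))) (cayley x) := by
  have h1 : ‖cayley x‖ ≠ 0 := by rw [norm_cayley]; exact one_ne_zero
  have h0 : cayley x ≠ 0 := norm_ne_zero_iff.1 h1
  have hc : ContinuousAt (fun v : Ambient n => ‖v‖⁻¹ • v - eLast n) (cayley x) :=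
    ((continuous_norm.continuousAt.inv₀ h1).smul continuousAt_id).sub continuousAt_const
  have h2 : ‖cayley x‖⁻¹ • cayley x - eLast n ≠ 0 := by
    rw [norm_cayley, inv_one, one_smul]
    exact cayley_ne_eLast x
  have hcomp : HasFDerivAt ((fun z => f (cayley z)) ∘ cayleyInv)
      (A.comp (fderiv ℝ cayleyInv (cayley x))) (cayley x) :=
    HasFDerivAt.comp _ (by rwa [cayleyInv_cayley]) (differentiableAt_cayleyInv x).hasFDerivAt
  refine hcomp.congr_of_eventuallyEq ?_
  filter_upwards [hc.eventually_ne h2, isOpen_ne.mem_nhds h0] with v hv hv0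
  rw [Function.comp_apply, cayley_cayleyInv hv0 hv]

/-- The Dirac operator of the sphere in Cayley coordinates. -/
theorem sphereDirac_cayley {f : Ambient n → Cl n} {x : Rn n} {A : Rn n →L[ℝ] Cl n}
    (hf : HasFDerivAt (fun z => f (cayley z)) A x) :
    sphereDirac f (cayley x) =
      (‖shift x‖ ^ 2 / 2) • ∑ j, vec (sandwich (shift x) (stdVec j)) *
          A ((Rn n).orthogonalProjectionOnto (stdVec j)) +
        ((n : ℝ) / 2) • (vec (cayley x) * f (cayley x)) := by
  set S := A.comp (fderiv ℝ cayleyInv (cayley x)) with hS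
  have hSv (v : Ambient n) : S v = (-(‖shift x‖ ^ 2 / 2)) •
      A ((Rn n).orthogonalProjectionOnto (sandwich (shift x) v)) := by
    rw [hS, ContinuousLinearMap.comp_apply, fderiv_cayleyInv, map_smul]
  have hlam : lambdaOp f (cayley x) = vec (cayley x) * clTrace (S : Ambient n →ₗ[ℝ] Cl n) := by
    have h0 : S (cayley x) = 0 := by
      rw [hSv, cayley_eq_sandwich, sandwich_sandwich, projection_eLast, map_zero, smul_zero]
    have h := sum_Ioi_vec_mul_vec (cayley x) (S : Ambient n →ₗ[ℝ] Cl n)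
    simp only [ContinuousLinearMap.coe_coe, h0, add_zero] at h
    rw [← h]
    simp only [lambdaOp, spherePartial, (hasFDerivAt_radial_of_cayley hf).fderiv, hS]
  rw [sphereDirac, hlam, mul_add, vec_mul_vec_mul_cancel, norm_cayley, mul_smul_comm, one_pow,
    neg_one_smul, ← sum_vec_map_mul (ℝ ∙ shift x)ᗮ.reflection, Finset.smul_sum,
    ← Finset.sum_neg_distrib]
  congr 1
  refine Finset.sum_congr rfl fun j _ => ?_
  rw [← sandwich_apply, ContinuousLinearMap.coe_coe, hSv, sandwich_sandwich, mul_smul_comm,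
    neg_smul, neg_neg]

/-! ### The conformal weight -/

theorem hasFDerivAt_norm_of_ne_zero {s : Ambient n} (hs : s ≠ 0) :
    HasFDerivAt (fun v : Ambient n => ‖v‖) (‖s‖⁻¹ • innerSL ℝ s) s := by
  have hρ := norm_ne_zero_iff.2 hs
  have h3 : HasFDerivAt (fun v : Ambient n => ‖v‖) (fderiv ℝ (fun v : Ambient n => ‖v‖) s) s :=
    (differentiableAt_id.norm ℝ hs).hasFDerivAt
  have h2 := (h3.pow 2).unique (hasStrictFDerivAt_norm_sq s).hasFDerivAt
  refine h3.congr_fderiv ?_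
  ext1 v
  have h4 := DFunLike.congr_fun h2 v
  simp at h4 ⊢
  field_simp
  linarith

theorem hasFDerivAt_weightJ (x : Rn n) :
    HasFDerivAt weightJ
      (LinearMap.toContinuousLinearMap (vec ∘ₗ ((‖shift x‖ ^ n)⁻¹ • LinearMap.id -
        (n * (‖shift x‖ ^ (n + 2))⁻¹) • (innerₗ (Ambient n) (shift x)).smulRight (shift x))) ∘L
          (Rn n).subtypeL) x := by
  have hs := shift_ne_zero x
  have hρ := norm_shift_ne_zero x
  have hnorm := hasFDerivAt_norm_of_ne_zero hs
  have hpow : HasFDerivAt (fun v : Ambient n => (‖v‖ ^ n)⁻¹)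
      ((-(n * (‖shift x‖ ^ (n + 2))⁻¹)) • innerSL ℝ (shift x)) (shift x) := by
    have h := ((hasDerivAt_pow n ‖shift x‖).inv (pow_ne_zero n hρ)).comp_hasFDerivAt _ hnorm
    refine h.congr_fderiv ?_
    rw [smul_smul]
    congr 1
    -- The power rule involves the truncated exponent `n - 1`, so `n = 0` is separate.
    cases n with
    | zero => simp
    | succ m =>
      rw [Nat.add_sub_cancel]
      field_simp
      ring
  have h := (vec.toContinuousLinearMap.hasFDerivAt.comp x
    ((hpow.comp x (hasFDerivAt_shift x)).smul (hasFDerivAt_shift x)))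
  have he : weightJ (n := n) = fun z => vec ((‖shift z‖ ^ n)⁻¹ • shift z) := by
    funext z
    rw [weightJ, map_smul]
  rw [he]
  refine HasFDerivAt.congr_fderiv h ?_
  ext1 v
  simp
  module

theorem sum_vec_sandwich_mul (s : Ambient n) (A : Ambient n →ₗ[ℝ] Cl n) :
    ∑ j, vec (sandwich s (stdVec j)) * A (sandwich s (stdVec j)) = clTrace A :=
  sum_vec_map_mul (ℝ ∙ s)ᗮ.reflection A

theorem sum_vec_mul_vec_mul_sandwich (s : Ambient n) (a : Fin (n + 1) → Cl n) :
    ∑ j, vec (stdVec j) * (vec s * a j) =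
      -(vec s * ∑ j, vec (sandwich s (stdVec j)) * a j) := by
  rw [Finset.mul_sum, ← Finset.sum_neg_distrib]
  refine Finset.sum_congr rfl fun j _ => ?_
  rw [← mul_assoc, ← mul_assoc, vec_mul_vec_sandwich, neg_mul, neg_neg]

theorem vec_shift_mul_vec_cayley (x : Rn n) :
    vec (shift x) * vec (cayley x) = -(vec (eLast n) * vec (shift x)) := by
  rw [cayley_eq_sandwich, vec_mul_vec_sandwich]

/-- The Dirac operator applied to the conformal weight. -/
theorem sum_vec_mul_fderiv_weightJ (x : Rn n) :
    ∑ j, vec (stdVec j) * fderiv ℝ weightJ x ((Rn n).orthogonalProjectionOnto (stdVec j)) =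
      (-(n * (‖shift x‖ ^ (n + 2))⁻¹)) • (vec (shift x) * vec (cayley x)) := by
  have hρ := norm_shift_ne_zero x
  have h (j : Fin (n + 1)) : vec (stdVec j) *
      fderiv ℝ weightJ x ((Rn n).orthogonalProjectionOnto (stdVec j)) =
      (‖shift x‖ ^ n)⁻¹ •
        (vec (stdVec j) * vec ((Rn n).orthogonalProjectionOnto (stdVec j) : Ambient n)) -
      (n * (‖shift x‖ ^ (n + 2))⁻¹) •
        (vec (stdVec j) * (inner ℝ (x : Ambient n) (stdVec j) • vec (shift x))) := by
    have hx : inner ℝ (shift x) ((Rn n).orthogonalProjectionOnto (stdVec j) : Ambient n) =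
        inner ℝ (x : Ambient n) (stdVec j) := by
      rw [← inner_projection_stdVec, projection_shift]
    rw [(hasFDerivAt_weightJ x).fderiv, ← hx]
    simp [mul_sub, -Submodule.coe_orthogonalProjectionOnto_apply]
  simp_rw [h]
  rw [Finset.sum_sub_distrib, ← Finset.smul_sum, ← Finset.smul_sum, sum_vec_mul_vec_projection,
    sum_vec_mul_inner_smul, projTrace_Rn, vec_shift_mul_vec_cayley]
  -- With `x = s - eₙ₊₁`, the part `s s = -ρ²` cancels the trace term, and `eₙ₊₁ s = -s C(x)` is
  -- what remains.
  have hx : vec (x : Ambient n) = vec (shift x) - vec (eLast n) := by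
    rw [shift, map_add, add_sub_cancel_right]
  rw [hx, sub_mul, vec_mul_self_eq_smul, smul_sub, smul_smul, smul_smul, smul_neg, neg_smul,
    neg_neg]
  have : (‖shift x‖ ^ n)⁻¹ * -(n : ℝ) = n * (‖shift x‖ ^ (n + 2))⁻¹ * -‖shift x‖ ^ 2 := by
    field_simp
    ring
  rw [this]
  abel

/-- The part of the Dirac operator of the pullback that comes from differentiating the reflection
of the second variable. -/
theorem sum_vec_sandwich_mul_fderiv_sandwich {p : Rn n → Cl n} (hp : IsMonogenic (Rn n) k p)
    (x u : Rn n) (w : Ambient n) (hu : (u : Ambient n) = sandwich (shift x) w) :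
    ∑ j, vec (sandwich (shift x) (stdVec j)) * fderiv ℝ p u ((Rn n).orthogonalProjectionOnto
      (fderiv ℝ (fun z : Rn n => sandwich (shift z) w) x
        ((Rn n).orthogonalProjectionOnto (stdVec j)))) =
      (-(2 / ‖shift x‖ ^ 2)) • (vec (u : Ambient n) * fderiv ℝ p u x) := by
  let B : Ambient n →ₗ[ℝ] Cl n := (fderiv ℝ p u : Rn n →ₗ[ℝ] Cl n) ∘ₗ
    ((Rn n).orthogonalProjectionOnto : Ambient n →ₗ[ℝ] Rn n)
  -- Up to the factor `-2/ρ²`, the derivative of the reflected variable along `v`, fed into `∂p` at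
  -- `u`, is `A(σ v)`.
  let A : Ambient n →ₗ[ℝ] Cl n := (innerₗ (Ambient n) (u : Ambient n)).smulRight (fderiv ℝ p u x) -
    inner ℝ (shift x) (u : Ambient n) • B
  have hA (h : Ambient n) : A h = inner ℝ (u : Ambient n) h • fderiv ℝ p u x -
    inner ℝ (shift x) (u : Ambient n) • fderiv ℝ p u ((Rn n).orthogonalProjectionOnto h) := rfl
  have hw : sandwich (shift x) (u : Ambient n) = w := by rw [hu, sandwich_sandwich]
  -- As `C(x) = σ(eₙ₊₁)`, this allows the projection of `eⱼ` onto `ℝⁿ` to be dropped, so that a full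
  -- contraction of `A` results.
  have hAy : A (cayley x) = 0 := by
    rw [hA, real_inner_comm, inner_cayley, projection_cayley, map_smul, smul_smul, ← sub_smul,
      mul_comm, sub_self, zero_smul]
  have hderiv (v : Rn n) : fderiv ℝ p u ((Rn n).orthogonalProjectionOnto
      (fderiv ℝ (fun z : Rn n => sandwich (shift z) w) x v)) =
        (-(2 / ‖shift x‖ ^ 2)) • A (sandwich (shift x) v) := by
    have h1 : inner ℝ w (v : Ambient n) = inner ℝ (u : Ambient n) (sandwich (shift x) v) := by
      rw [hu, inner_sandwich_sandwich]
    have h2 : inner ℝ (shift x) w = -inner ℝ (shift x) (u : Ambient n) := by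
      rw [← hw, ← inner_sandwich_left, sandwich_self, inner_neg_left]
    have h3 : fderiv ℝ (fun z : Rn n => sandwich (shift z) w) x v = (-(2 / ‖shift x‖ ^ 2)) •
        (inner ℝ w (v : Ambient n) • shift x + inner ℝ (shift x) w • sandwich (shift x) v) := by
      rw [(hasFDerivAt_sandwich_shift x w).fderiv]
      rfl
    rw [h3, hA, map_smul, map_smul, map_add, map_add, map_smul, map_smul, map_smul, map_smul,
      projection_shift, h1, h2, neg_smul (inner ℝ (shift x) _), ← sub_eq_add_neg]
  have hproj (j : Fin (n + 1)) : A (sandwich (shift x)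
      ((Rn n).orthogonalProjectionOnto (stdVec j) : Ambient n)) =
        A (sandwich (shift x) (stdVec j)) := by
    rw [coe_projection_Rn, map_sub, map_smul, ← cayley_eq_sandwich, map_sub, map_smul, hAy,
      smul_zero, sub_zero]
  simp_rw [hderiv, hproj, mul_smul_comm]
  -- The second part of `A` contracts to a multiple of `D p = 0`; the first gives `u ∂ₓ p`.
  rw [← Finset.smul_sum, sum_vec_sandwich_mul, map_sub, map_smul,
    ← dirac_eq_clTrace, hp.2, smul_zero, sub_zero, clTrace_apply]
  exact congrArg _ (sum_vec_mul_inner_smul _ _)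

/-! ### Derivatives in a parameter and the Dirac operator of the pullback -/

/-- A derivative with respect to a parameter of a family in `𝓜_k` lies in `𝓜_k`. -/
theorem isMonogenic_fderiv_param {H : Submodule ℝ (Ambient n)} {E : Type*} [NormedAddCommGroup E]
    [NormedSpace ℝ E] {f : E → H → Cl n} {x : E}
    (hd : ∀ u, DifferentiableAt ℝ (fun z => f z u) x)
    (hm : ∀ᶠ z in 𝓝 x, IsMonogenic H k (f z)) (v : E) :
    IsMonogenic H k fun u => fderiv ℝ (fun z => f z u) x v := by
  refine mem_monogenicSubmodule.1 <| (isClosed_monogenicSubmodule H k).mem_of_tendsto (b := 𝓝[≠] (0 : ℝ))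
    (f := fun t => t⁻¹ • (f (x + t • v) - f x)) (tendsto_pi_nhds.2 fun u => ?_) ?_
  · simpa using hasDerivAt_iff_tendsto_slope_zero.1 ((hd u).hasFDerivAt.hasLineDerivAt v)
  · have hc : Filter.Tendsto (fun t : ℝ => x + t • v) (𝓝[≠] 0) (𝓝 x) := by
      have : ContinuousAt (fun t : ℝ => x + t • v) 0 := by fun_prop
      simpa using this.tendsto.mono_left nhdsWithin_le_nhds
    filter_upwards [hc.eventually hm] with t ht
    exact (monogenicSubmodule H k).smul_mem _ ((monogenicSubmodule H k).sub_mem ht hm.self_of_nhds)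

/-- In Cayley coordinates `D_s g` is a sum of vectors, independent of `u`, times elements of `𝓜_k`:
parameter derivatives of `g`, and `g` itself. -/
theorem inFischerSpace_sphereDiracX {g : Ambient n → Rn n → Cl n} {x : Rn n}
    (hd : ∀ u, DifferentiableAt ℝ (fun z => g (cayley z) u) x)
    (hm : ∀ᶠ z in 𝓝 x, IsMonogenic (Rn n) k (g (cayley z))) :
    InFischerSpace (Rn n) k (sphereDiracX g (cayley x)) := by
  have h : sphereDiracX g (cayley x) =
      (‖shift x‖ ^ 2 / 2) • ∑ j, (fun u => vec (sandwich (shift x) (stdVec j)) *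
        fderiv ℝ (fun z => g (cayley z) u) x ((Rn n).orthogonalProjectionOnto (stdVec j))) +
      ((n : ℝ) / 2) • fun u => vec (cayley x) * g (cayley x) u := by
    funext u
    rw [sphereDiracX, sphereDirac_cayley (hd u).hasFDerivAt]
    simp
  rw [h]
  exact (fischerSubmodule (Rn n) k).add_mem (Submodule.smul_mem _ _ (Submodule.sum_mem _ fun j _ =>
    (isMonogenic_fderiv_param hd hm _).inFischerSpace_vec_mul _))
    (Submodule.smul_mem _ _ (hm.self_of_nhds.inFischerSpace_vec_mul _))

section Partial

variable {E F G : Type*} [NormedAddCommGroup E] [NormedSpace ℝ E] [NormedAddCommGroup F]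
  [NormedSpace ℝ F] [NormedAddCommGroup G] [NormedSpace ℝ G] {f : E → F → G} {f' : E × F →L[ℝ] G}
  {x : E} {u : F}

theorem hasFDerivAt_partial_left (h : HasFDerivAt (fun p : E × F => f p.1 p.2) f' (x, u)) :
    HasFDerivAt (fun z => f z u) (f'.comp (.inl ℝ E F)) x :=
  HasFDerivAt.comp (g := fun p : E × F => f p.1 p.2) (f := fun z => (z, u)) x h
    (hasFDerivAt_prodMk_left x u)

theorem hasFDerivAt_partial_right (h : HasFDerivAt (fun p : E × F => f p.1 p.2) f' (x, u)) :
    HasFDerivAt (fun z => f x z) (f'.comp (.inr ℝ E F)) u :=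
  HasFDerivAt.comp (g := fun p : E × F => f p.1 p.2) (f := fun z => (x, z)) u h
    (hasFDerivAt_prodMk_right x u)

/-- The derivative of `z ↦ f z (φ z)` as the sum of the partial derivatives. -/
theorem hasFDerivAt_apply_apply {φ : E → F} {φ' : E →L[ℝ] F} (hφ : HasFDerivAt φ φ' x)
    (hu : φ x = u) (h : DifferentiableAt ℝ (fun p : E × F => f p.1 p.2) (x, u)) :
    HasFDerivAt (fun z => f z (φ z))
      (fderiv ℝ (fun z => f z u) x + (fderiv ℝ (f x) u).comp φ') x := by
  subst hu
  have hc := HasFDerivAt.comp (g := fun p : E × F => f p.1 p.2) x h.hasFDerivAt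
    ((hasFDerivAt_id x).prodMk hφ)
  refine HasFDerivAt.congr_fderiv hc ?_
  rw [(hasFDerivAt_partial_left h.hasFDerivAt).fderiv,
    (hasFDerivAt_partial_right h.hasFDerivAt).fderiv]
  ext v
  simp [← map_add]

end Partial

/-- The Dirac operator of the pullback in terms of the Dirac operator of the sphere. -/
theorem diracX_cayleyPullback {g : Ambient n → Rn n → Cl n} {x u : Rn n} {w : Ambient n}
    (hg : DifferentiableAt ℝ (fun p : Rn n × Rn n => g (cayley p.1) p.2) (x, u))
    (hmono : IsMonogenic (Rn n) k (g (cayley x))) (hu : (u : Ambient n) = sandwich (shift x) w) :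
    diracX (cayleyPullback g) x w =
      (-2 * (‖shift x‖ ^ (n + 2))⁻¹) • (vec (shift x) *
        (sphereDiracX g (cayley x) u - vec (u : Ambient n) * fderiv ℝ (g (cayley x)) u x)) := by
  have hρ := norm_shift_ne_zero x
  have hA : HasFDerivAt (fun z => g (cayley z) u) _ x :=
    (hasFDerivAt_partial_left (f := fun z => g (cayley z))
      hg.hasFDerivAt).differentiableAt.hasFDerivAt
  set A := fderiv ℝ (fun z => g (cayley z) u) x
  have hpu : (Rn n).orthogonalProjectionOnto (sandwich (shift x) w) = u := by
    rw [← hu, Submodule.orthogonalProjectionOnto_mem_subspace_eq_self]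
  have hcomp := hasFDerivAt_apply_apply (f := fun z => g (cayley z))
    ((Rn n).orthogonalProjectionOnto.hasFDerivAt.comp x
      (hasFDerivAt_sandwich_shift x w).differentiableAt.hasFDerivAt) hpu hg
  have hF (v : Rn n) : fderiv ℝ (fun z => cayleyPullback g z w) x v =
      (‖shift x‖ ^ n)⁻¹ • (vec (shift x) * A v) +
      (‖shift x‖ ^ n)⁻¹ • (vec (shift x) * fderiv ℝ (g (cayley x)) u
        ((Rn n).orthogonalProjectionOnto (fderiv ℝ (fun z : Rn n => sandwich (shift z) w) x v))) +
      fderiv ℝ weightJ x v * g (cayley x) u := by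
    have h := fderiv_mul_apply (hasFDerivAt_weightJ x).differentiableAt.hasFDerivAt hcomp v
    simp only [Function.comp_apply, hpu] at h
    refine Eq.trans h ?_
    rw [weightJ, smul_mul_assoc, ← smul_add, ← mul_add]
    rfl
  have hsum : diracX (cayleyPullback g) x w =
      (‖shift x‖ ^ n)⁻¹ • ∑ j, vec (stdVec j) * (vec (shift x) *
        A ((Rn n).orthogonalProjectionOnto (stdVec j))) +
      (‖shift x‖ ^ n)⁻¹ • ∑ j, vec (stdVec j) * (vec (shift x) * fderiv ℝ (g (cayley x)) u
        ((Rn n).orthogonalProjectionOnto (fderiv ℝ (fun z : Rn n => sandwich (shift z) w) x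
          ((Rn n).orthogonalProjectionOnto (stdVec j))))) +
      (∑ j, vec (stdVec j) * fderiv ℝ weightJ x ((Rn n).orthogonalProjectionOnto (stdVec j))) *
        g (cayley x) u := by
    rw [diracX, dirac]
    simp_rw [hF, mul_add, mul_smul_comm, ← mul_assoc]
    rw [Finset.sum_add_distrib, Finset.sum_add_distrib, Finset.smul_sum, Finset.smul_sum,
      Finset.sum_mul]
  rw [hsum, sum_vec_mul_vec_mul_sandwich, sum_vec_mul_vec_mul_sandwich,
    sum_vec_sandwich_mul_fderiv_sandwich hmono x u w hu, sum_vec_mul_fderiv_weightJ, sphereDiracX,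
    sphereDirac_cayley hA]
  simp only [mul_sub, mul_add, mul_smul_comm, smul_sub, smul_add, smul_smul, smul_mul_assoc,
    smul_neg, mul_assoc]
  -- The constants of the three terms: point derivative, weight, reflected variable.
  have e1 : -2 * ((‖shift x‖ ^ (n + 2))⁻¹ * (‖shift x‖ ^ 2 / 2)) = -(‖shift x‖ ^ n)⁻¹ := by
    field_simp
    ring
  have e2 : -2 * ((‖shift x‖ ^ (n + 2))⁻¹ * ((n : ℝ) / 2)) = -(n * (‖shift x‖ ^ (n + 2))⁻¹) := by
    ring
  have e3 : (‖shift x‖ ^ n)⁻¹ * -(2 / ‖shift x‖ ^ 2) = -2 * (‖shift x‖ ^ (n + 2))⁻¹ := by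
    field_simp
    ring
  rw [e1, e2, e3, neg_smul (‖shift x‖ ^ n)⁻¹]
  abel

end

end CliffordSphere

/-! ### The intertwining relation -/

theorem theorem4 (n k : ℕ) (U : Set (Rn n)) (hU : IsOpen U)
    (g : Ambient n → Rn n → Cl n)
    (hdiff : DifferentiableOn ℝ (fun p : Rn n × Rn n => g (cayley p.1) p.2) (U ×ˢ Set.univ))
    (hmono : ∀ x ∈ U, IsMonogenic (Rn n) k (g (cayley x)))
    (x : Rn n) (hx : x ∈ U) :
    InFischerSpace (Rn n) k (sphereDiracX g (cayley x)) ∧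
    InFischerSpace (hyperplane x) k
      (diracX (fun z (w : hyperplane x) => cayleyPullback g z w) x) ∧
    ∀ (w : hyperplane x) (u : Rn n), (u : Ambient n) = sandwich (shift x) w →
      (-2 : ℝ) • (weightJneg x * sphereRaritaSchwinger k g (cayley x) u) =
        raritaSchwinger (hyperplane x) k (fun z w => cayleyPullback g z w) x w := by
  have hg (u : Rn n) :
      DifferentiableAt ℝ (fun p : Rn n × Rn n => g (cayley p.1) p.2) (x, u) :=
    hdiff.differentiableAt ((hU.prod isOpen_univ).mem_nhds ⟨hx, Set.mem_univ u⟩)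
  have hd (u : Rn n) : DifferentiableAt ℝ (fun z => g (cayley z) u) x :=
    (hasFDerivAt_partial_left (f := fun z => g (cayley z)) (hg u).hasFDerivAt).differentiableAt
  have hm : ∀ᶠ z in nhds x, IsMonogenic (Rn n) k (g (cayley z)) := by
    filter_upwards [hU.mem_nhds hx] with z hz using hmono z hz
  have hS : InFischerSpace (Rn n) k (sphereDiracX g (cayley x)) :=
    inFischerSpace_sphereDiracX hd hm
  -- Subtracting `u ∂ₓ g ∈ u 𝓜_{k-1}` does not change the monogenic part.
  have hpart : IsMonogenicPart (Rn n) k (fun u => sphereDiracX g (cayley x) u -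
      vec (u : Ambient n) * fderiv ℝ (g (cayley x)) u x)
      (sphereRaritaSchwinger k g (cayley x)) := by
    refine ⟨hS.isMonogenicPart.1, ?_⟩
    convert hS.isMonogenicPart.2.add
      (((hmono x hx).isVecMulMonogenic_fderiv x).const_smul (-1)) using 1
    ext u
    simp only [Pi.add_apply, Pi.neg_apply, neg_one_smul, sphereRaritaSchwinger]
    abel
  have hF : IsMonogenicPart (hyperplane x) k
      (diracX (fun z (w : hyperplane x) => cayleyPullback g z w) x)
      ((-2 * (‖shift x‖ ^ (n + 2))⁻¹) • fun w : hyperplane x => vec (shift x) *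
        sphereRaritaSchwinger k g (cayley x) (sandwichTo (shift x) (Rn n) w)) := by
    have h : diracX (fun z (w : hyperplane x) => cayleyPullback g z w) x =
        (-2 * (‖shift x‖ ^ (n + 2))⁻¹) • fun w : hyperplane x => vec (shift x) *
          (sphereDiracX g (cayley x) (sandwichTo (shift x) (Rn n) w) -
            vec (sandwichTo (shift x) (Rn n) w : Ambient n) *
              fderiv ℝ (g (cayley x)) (sandwichTo (shift x) (Rn n) w) x) :=
      funext fun w =>
        diracX_cayleyPullback (hg _) (hmono x hx) (coe_sandwichTo (shift x) (Rn n) w)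
    rw [h]
    exact (hpart.comp_sandwichTo (shift x)).const_smul (-2 * (‖shift x‖ ^ (n + 2))⁻¹)
  refine ⟨hS, ⟨_, hF⟩, fun w u hu => ?_⟩
  have hw : sandwichTo (shift x) (Rn n) w = u := Subtype.ext hu.symm
  rw [raritaSchwinger, hF.projMonogenic_eq, Pi.smul_apply, hw, weightJneg, smul_mul_assoc,
    smul_smul]
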